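/- Let $f(x)=\max_{a\in\mathcal A}\{\lambda_a+\langle a,x\rangle\}$ be a tropical polynomial in three variables ($\mathcal A\subset\mathbb{N}_0^3$ finite, $\lambda_a\in\mathbb{R}$) with Newton polytope $\mathrm{conv}(\mathcal A)=\mathrm{conv}\{0,2e_1,2e_2,2e_3\}$, and let $X\subset\mathbb{R}^3$ be the tropical quadric surface it defines, i.e. the set of points at which the maximum is attained at least twice. Suppose that $X$ is smooth: in the regular subdivision of the Newton polytope induced by $a\mapsto\lambda_a$ (whose cells are the projections of the top faces of $\mathrm{conv}\{(a,\lambda_a)\}$), every maximal cell is a lattice simplex of volume $\frac16$. Consider $X$ with its polyhedral structure dual to this subdivision: the cells of $X$ are the sets $\Delta^\vee$ of the points at which all terms at vertices of $\Delta$ are maximal, for the cells $\Delta$ of dimension at least $1$ of the subdivision. A tropical line with (possibly coinciding) vertices $v,w\in\mathbb{R}^3$ is the union of the segment $[v,w]$, of two rays from $v$ and of two rays from $w$, where the four rays have the directions $-e_1,-e_2,-e_3,e_1+e_2+e_3$ (in some order), such that at each vertex the primitive integer vectors of the outgoing edges sum to zero. Then $X$ has a unique compact $2$-cell $\bar X$,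 and $\bar X$ has a normal vector $-e_i+e_j+e_k$ for some permutation $(i,j,k)$ of $(1,2,3)$. For such a permutation and every point $p\in\bar X$, the following holds. Let $p^-,p^+$ be the points at which the affine line $p+\mathbb{R}(e_i+e_j)$ leaves $\bar X$ (in the two directions), and let $q^-,q^+$ be the points at which the affine line $p+\mathbb{R}(e_i+e_k)$ leaves $\bar X$. Then there are a tropical line $L_p$ with vertices $p^-,p^+$ and a tropical line $L_p'$ with vertices $q^-,q^+$; both are contained in $X$ and contain $p$, and $L_p\neq L_p'$. -/

import Mathlib

open scoped Matrix

noncomputable section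

namespace TropicalQuadric

/-- Points and vectors of `ℝ³`; the Euclidean inner product is `⬝ᵥ`. -/
abbrev R3 : Type := Fin 3 → ℝ

/-- The standard basis vector `eᵢ` (indices `0, 1, 2`). -/
def e (i : Fin 3) : R3 := Pi.single i 1

/-- An exponent vector in `ℕ³`, seen as a point of `ℝ³`. -/
def toR3 (a : Fin 3 → ℕ) : R3 := fun i => (a i : ℝ)

/-- An integer vector, seen as a vector of `ℝ³`. -/
def intToR3 (u : Fin 3 → ℤ) : R3 := fun i => (u i : ℝ)

/-- The dimension of (the affine hull of) a nonempty subset of `ℝ³`. -/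
def dim (S : Set R3) : ℕ := Module.finrank ℝ (vectorSpan ℝ S)

/-! ### Tropical polynomials and tropical surfaces -/

/-- A tropical polynomial in three variables over `(ℝ, max, +)`. Only the values of `coeff` on
`support` matter. -/
structure TropicalPolynomial where
  support : Finset (Fin 3 → ℕ)
  nonempty : support.Nonempty
  coeff : (Fin 3 → ℕ) → ℝ

namespace TropicalPolynomial

variable (f : TropicalPolynomial)

/-- The value `λ_a + ⟨a, x⟩` of the term with exponent `a`. -/
def term (a : Fin 3 → ℕ) (x : R3) : ℝ := f.coeff a + toR3 a ⬝ᵥ x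

/-- The function `x ↦ max_a (λ_a + ⟨a, x⟩)`. -/
def eval (x : R3) : ℝ := f.support.sup' f.nonempty fun a => f.term a x

/-- The tropical surface: the points at which the maximum is attained at least twice. -/
def surface : Set R3 :=
  {x | ∃ a ∈ f.support, ∃ b ∈ f.support, a ≠ b ∧ f.term a x = f.eval x ∧ f.term b x = f.eval x}

/-- The Newton polytope. -/
def newtonPolytope : Set R3 := convexHull ℝ (toR3 '' (f.support : Set (Fin 3 → ℕ)))

/-- The polytope in `ℝ³ × ℝ` spanned by the lifted points `(a, λ_a)`. -/
def liftedPolytope : Set (R3 × ℝ) :=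
  convexHull ℝ ((fun a => (toR3 a, f.coeff a)) '' (f.support : Set (Fin 3 → ℕ)))

/-- The top faces of the lifted polytope: the faces on which a linear functional with positive
last coefficient (normalised to `1`) is maximal. -/
def IsTopFace (F : Set (R3 × ℝ)) : Prop :=
  ∃ c : R3, F = {q | q ∈ f.liftedPolytope ∧
    ∀ q' ∈ f.liftedPolytope, c ⬝ᵥ q'.1 + q'.2 ≤ c ⬝ᵥ q.1 + q.2}

/-- The (nonempty) cells of the regular subdivision of the Newton polytope induced by the
coefficients: the projections to `ℝ³` of the top faces. -/
def subdivision : Set (Set R3) := {D | ∃ F, f.IsTopFace F ∧ D = Prod.fst '' F}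

/-- The subset of the surface dual to a cell `D` of the subdivision: all terms at vertices of `D`
are maximal. -/
def dualCell (D : Set R3) : Set R3 :=
  {x | ∀ a ∈ f.support, toR3 a ∈ Set.extremePoints ℝ D → ∀ b ∈ f.support, f.term b x ≤ f.term a x}

/-- The cells of the tropical surface, as a polyhedral complex: the duals of the cells of
dimension at least one of the subdivision. -/
def IsCell (C : Set R3) : Prop := ∃ D ∈ f.subdivision, 1 ≤ dim D ∧ C = f.dualCell D

/-- The two-dimensional cells of the tropical surface. -/
def IsTwoCell (C : Set R3) : Prop := f.IsCell C ∧ dim C = 2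

end TropicalPolynomial

/-! ### Degree and smoothness -/

/-- The simplex with vertices `0, δ e₁, δ e₂, δ e₃`. -/
def Gam (δ : ℕ) : Set R3 := convexHull ℝ (insert 0 (Set.range fun i => (δ : ℝ) • e i))

/-- A lattice polytope: the convex hull of finitely many lattice points. -/
def IsLatticePolytope (P : Set R3) : Prop :=
  ∃ S : Finset (Fin 3 → ℤ), P = convexHull ℝ (intToR3 '' (S : Set (Fin 3 → ℤ)))

/-- An elementary (unimodular) polytope: a three-dimensional lattice polytope of
volume `1 / 3!`. -/
def IsElementary (P : Set R3) : Prop :=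
  IsLatticePolytope P ∧ dim P = 3 ∧ MeasureTheory.volume P = ENNReal.ofReal (1 / 6)

/-- A three-dimensional simplex. -/
def IsSimplex (P : Set R3) : Prop :=
  ∃ v : Fin 4 → R3, AffineIndependent ℝ v ∧ P = convexHull ℝ (Set.range v)

/-- All cells that are maximal for inclusion are simplices and elementary. -/
def IsElementaryTriangulation (S : Set (Set R3)) : Prop :=
  ∀ P, Maximal (· ∈ S) P → IsSimplex P ∧ IsElementary P

/-- The surface of `f` has degree `δ`. -/
def TropicalPolynomial.HasDegree (f : TropicalPolynomial) (δ : ℕ) : Prop :=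
  f.newtonPolytope = Gam δ

/-- The surface of `f` is smooth. -/
def TropicalPolynomial.IsSmooth (f : TropicalPolynomial) : Prop :=
  IsElementaryTriangulation f.subdivision

/-! ### Tropical lines -/

/-- The directions `-e₁, -e₂, -e₃, e₁ + e₂ + e₃` of the unbounded rays of a tropical line. -/
def rayDir : Fin 4 → Fin 3 → ℤ := ![![-1, 0, 0], ![0, -1, 0], ![0, 0, -1], ![1, 1, 1]]

/-- The closed ray from `v` in direction `u`. -/
def ray (v : R3) (u : Fin 3 → ℤ) : Set R3 := {x | ∃ t : ℝ, 0 ≤ t ∧ x = v + t • intToR3 u}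

/-- A primitive integer vector. -/
def IsPrimitiveVector (u : Fin 3 → ℤ) : Prop := ∀ d : ℤ, (∀ i, d ∣ u i) → IsUnit d

/-- `L` is a tropical line in `ℝ³` with vertices `v` and `w` (possibly coinciding, in which case
`L` is degenerate): it consists of the segment from `v` to `w`, of two of the four unbounded rays
attached to `v` and of the other two attached to `w`, and it is balanced at each vertex. At the
vertex of a degenerate line balancing reads `∑ rayDir = 0`, which always holds. -/
def IsTropicalLineWithVertices (v w : R3) (L : Set R3) : Prop :=
  ∃ τ : Equiv.Perm (Fin 4),
    L = segment ℝ v w ∪ (ray v (rayDir (τ 0)) ∪ ray v (rayDir (τ 1))) ∪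
      (ray w (rayDir (τ 2)) ∪ ray w (rayDir (τ 3))) ∧
    (v ≠ w → ∃ u : Fin 3 → ℤ, IsPrimitiveVector u ∧
      (∃ t : ℝ, 0 < t ∧ w - v = t • intToR3 u) ∧
      rayDir (τ 0) + rayDir (τ 1) + u = 0 ∧ rayDir (τ 2) + rayDir (τ 3) + -u = 0)

/-- `p₁` and `p₂` are the points at which the affine line `p + ℝ d` leaves the set `C`, in
direction `-d` and in direction `d` respectively. -/
def AreExitPoints (C : Set R3) (p d p₁ p₂ : R3) : Prop :=
  ∃ s t : ℝ, IsLeast {r : ℝ | p + r • d ∈ C} s ∧ IsGreatest {r : ℝ | p + r • d ∈ C} t ∧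
    p₁ = p + s • d ∧ p₂ = p + t • d

end TropicalQuadric

end

namespace TropicalQuadric

/-! Everything is read off from the center (1/2, 1/2, 1/2) of the Newton polytope. It lies in some
cell of the subdivision, because `f.eval x - center ⬝ᵥ x` is coercive and at its minimum the center
belongs to the hull of the maximal exponents (`exists_center_mem_cellAt`). Twice the center is a
lattice point, so its barycentric coordinates in a unimodular simplex are half-integers: the center
is the midpoint of an edge with endpoints a + b = (1,1,1) (`exists_central_edge`). As degrees are at
most 2, up to order a = e_i and b = e_j + e_k, and b - a is the asserted normal.

The 2-cell dual to this edge is compact, since the coercive function is constant on it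
(`isCompact_edgeDual`). Conversely, a cell dual to an edge in a facet of the Newton polytope
contains a ray along the outer normal; the endpoints of an edge in no facet sum to (1,1,1), and
convexity leaves room for only one such edge (`eq_edgeDual_of_isCompact`).

In direction e_i + e_j both a and b have slope 1. Where the line through p leaves the cell, a term
of larger slope becomes maximal: slope 2 at one end and, for the opposite direction, slope 0 at the
other. Each such exponent shares one facet with a and another with b, and the outer normals of these
facets are the two rays needed there (`exists_line`). The two tropical lines can coincide only if
all four exits happen at p itself; then a or b would be the midpoint of two other vertices of one
unimodular simplex, which is impossible (`false_of_degenerate`). -/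

theorem toR3_injective : Function.Injective toR3 := fun u v h =>
  funext fun i => by simpa [toR3] using congrFun h i

/-! ### Extreme points of polytopes. -/

/-- A polytope is the convex hull of its vertices. -/
theorem convexHull_extremePoints_of_finite {S : Set R3} (hS : S.Finite) :
    convexHull ℝ ((convexHull ℝ S).extremePoints ℝ) = convexHull ℝ S := by
  have h := closure_convexHull_extremePoints (hS.isCompact_convexHull ℝ) (convex_convexHull ℝ S)
  rwa [((hS.subset extremePoints_convexHull_subset).isClosed_convexHull ℝ).closure_eq] at h

/-- A vertex that is not extreme would lie in the hull of the remaining ones, against affine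
independence. -/
theorem range_subset_extremePoints {ι : Type*} [Finite ι] {v : ι → R3}
    (hv : AffineIndependent ℝ v) :
    Set.range v ⊆ (convexHull ℝ (Set.range v)).extremePoints ℝ := by
  rintro _ ⟨l, rfl⟩
  by_contra hl
  have h1 : v l ∈ convexHull ℝ ((convexHull ℝ (Set.range v)).extremePoints ℝ) := by
    rw [convexHull_extremePoints_of_finite (Set.finite_range v)]
    exact subset_convexHull ℝ _ ⟨l, rfl⟩
  have h2 : (convexHull ℝ (Set.range v)).extremePoints ℝ ⊆ v '' (Set.univ \ {l}) := by
    intro z hz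
    obtain ⟨m, rfl⟩ := extremePoints_convexHull_subset hz
    exact ⟨m, ⟨trivial, fun hm => hl (by rw [← Set.mem_singleton_iff.1 hm]; exact hz)⟩, rfl⟩
  exact hv.notMem_affineSpan_sdiff l Set.univ
    (convexHull_subset_affineSpan _ (convexHull_mono h2 h1))

/-- The vertices of a simplex lie in every set that spans it. -/
theorem range_subset_of_convexHull_eq {ι : Type*} [Finite ι] {v : ι → R3}
    (hv : AffineIndependent ℝ v) {S : Set R3}
    (h : convexHull ℝ (Set.range v) = convexHull ℝ S) : Set.range v ⊆ S :=
  (range_subset_extremePoints hv).trans (h ▸ extremePoints_convexHull_subset)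

/-! ### The standard simplex and unimodular simplices -/

theorem mem_Gam_one {x : R3} (h0 : ∀ i, 0 ≤ x i) (h1 : ∑ i, x i ≤ 1) : x ∈ Gam 1 := by
  have hc : Convex ℝ (Gam 1) := convex_convexHull ℝ _
  have hsub : insert 0 (Set.range fun i => ((1 : ℕ) : ℝ) • e i) ⊆ Gam 1 := subset_convexHull ℝ _
  have hz : ∀ o : Option (Fin 3), (o.elim (0 : R3) e) ∈ Gam 1 := by
    rintro (_ | i)
    · exact hsub (Set.mem_insert _ _)
    · exact hsub (Set.mem_insert_of_mem _ ⟨i, by simp⟩)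
  have := hc.sum_mem (t := Finset.univ)
    (w := fun o : Option (Fin 3) => o.elim (1 - ∑ i, x i) x) (z := fun o => o.elim (0 : R3) e)
    (by rintro (_ | i) - <;> simp [h0, h1]) (by simp [Fintype.sum_option]) (fun o _ => hz o)
  convert this using 1
  ext r
  fin_cases r <;> simp [Fintype.sum_option, Fin.sum_univ_three, e, Pi.single_apply]

-- The open ℓ¹ unit ball has volume 8/6 and is covered by the eight coordinate reflections of the
-- simplex. The lower bound suffices: an integer determinant scales this volume, so it is enough to
-- bound that determinant by 1.
open MeasureTheory in
theorem volume_Gam_one : ENNReal.ofReal (1 / 6) ≤ volume (Gam 1) := by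
  have hball := volume_sum_rpow_lt_one (Fin 3) (p := 1) le_rfl
  have hval : (2 * Real.Gamma (1 / 1 + 1)) ^ Fintype.card (Fin 3) /
      Real.Gamma (Fintype.card (Fin 3) / 1 + 1) = 8 * (1 / 6) := by
    have h3 : Real.Gamma (3 + 1) = 6 := by
      have := Real.Gamma_nat_eq_factorial 3
      norm_num [Nat.factorial] at this ⊢
    have h1 : Real.Gamma (1 + 1) = 1 := by
      have := Real.Gamma_nat_eq_factorial 1
      norm_num [Nat.factorial] at this ⊢
    simp only [Fintype.card_fin, div_one, Nat.cast_ofNat, h3, h1]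
    norm_num
  rw [hval] at hball
  let s : (Fin 3 → Bool) → Fin 3 → ℝ := fun ε i => if ε i then 1 else -1
  have hcover : {x : Fin 3 → ℝ | ∑ i, |x i| ^ (1 : ℝ) < 1} ⊆
      ⋃ ε, Matrix.toLin' (Matrix.diagonal (s ε)) '' Gam 1 := by
    intro x hx
    simp only [Real.rpow_one, Set.mem_ofPred_eq] at hx
    refine Set.mem_iUnion.2 ⟨fun i => decide (0 ≤ x i), fun i => |x i|,
      mem_Gam_one (fun i => abs_nonneg _) hx.le, ?_⟩
    ext i
    rw [Matrix.toLin'_apply, Matrix.mulVec_diagonal]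
    by_cases h : 0 ≤ x i
    · simp [s, h, abs_of_nonneg]
    · simp [s, h, abs_of_neg (not_le.1 h)]
  have hpiece : ∀ ε, volume (Matrix.toLin' (Matrix.diagonal (s ε)) '' Gam 1) = volume (Gam 1) := by
    intro ε
    rw [Measure.addHaar_image_linearMap, LinearMap.det_toLin', Matrix.det_diagonal,
      Finset.abs_prod]
    have : ∀ i, |s ε i| = 1 := fun i => by by_cases h : ε i <;> simp [s, h]
    simp [this]
  have hle := (measure_mono hcover).trans (measure_iUnion_fintype_le volume _)
  simp only [hpiece, Finset.sum_const, Finset.card_univ, Fintype.card_pi, Fintype.card_bool,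
    Finset.prod_const, Fintype.card_fin, nsmul_eq_mul, hball] at hle
  rw [ENNReal.ofReal_mul (by norm_num)] at hle
  refine (ENNReal.mul_le_mul_iff_right (a := 8) (by norm_num) (by norm_num)).1 ?_
  have h8 : ((2 ^ 3 : ℕ) : ENNReal) = 8 := by norm_num
  rwa [h8, ENNReal.ofReal_ofNat] at hle

/-- The integer matrix of the edge vectors of a lattice simplex at its first vertex. -/
def edgeMatrix (v : Fin 4 → Fin 3 → ℕ) : Matrix (Fin 3) (Fin 3) ℤ :=
  Matrix.of fun r l => (v l.succ r : ℤ) - v 0 r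

theorem isUnit_det_edgeMatrix {v : Fin 4 → Fin 3 → ℕ}
    (h : MeasureTheory.volume (convexHull ℝ (Set.range (toR3 ∘ v))) = ENNReal.ofReal (1 / 6)) :
    IsUnit (edgeMatrix v).det := by
  set M : Matrix (Fin 3) (Fin 3) ℝ := (edgeMatrix v).map (Int.castRingHom ℝ) with hM
  have himg : convexHull ℝ (Set.range (toR3 ∘ v)) =
      (fun z => toR3 (v 0) + z) '' (Matrix.toLin' M '' Gam 1) := by
    have hset : Set.range (toR3 ∘ v) = ((AffineMap.const ℝ R3 (toR3 (v 0)) +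
        (Matrix.toLin' M).toAffineMap : R3 →ᵃ[ℝ] R3)) ''
        insert 0 (Set.range fun i => ((1 : ℕ) : ℝ) • e i) := by
      rw [Set.image_insert_eq, ← Set.range_comp, ← Fin.range_cons]
      congr 1
      ext l r
      refine Fin.cases ?_ (fun i => ?_) l
      · simp
      · simp [e, hM, edgeMatrix, toR3]
    rw [hset, ← AffineMap.image_convexHull, Set.image_image]
    rfl
  rw [himg, Set.image_add_left, MeasureTheory.measure_preimage_add,
    MeasureTheory.Measure.addHaar_image_linearMap, LinearMap.det_toLin', hM,
    ← RingHom.mapMatrix_apply, ← RingHom.map_det] at h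
  set d := (edgeMatrix v).det
  simp only [eq_intCast] at h
  have hle : ENNReal.ofReal |(d : ℝ)| * ENNReal.ofReal (1 / 6) ≤ ENNReal.ofReal (1 / 6) :=
    (mul_le_mul_right volume_Gam_one _).trans h.le
  rw [← ENNReal.ofReal_mul (abs_nonneg _), ENNReal.ofReal_le_ofReal_iff (by norm_num)] at hle
  have h1 : |(d : ℝ)| ≤ 1 := by linarith
  have h1' : |d| ≤ 1 := by exact_mod_cast h1
  have h0 : d ≠ 0 := by
    intro h0
    rw [h0] at h
    norm_num at h
  rw [Int.isUnit_iff]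
  rw [abs_le] at h1'
  omega

/-- Affine functions take arbitrary prescribed values at the vertices of a simplex. -/
theorem exists_interpolation {v : Fin 4 → Fin 3 → ℕ} (hv : IsUnit (edgeMatrix v).det)
    (h : Fin 4 → ℝ) : ∃ (y : R3) (c : ℝ), ∀ l, toR3 (v l) ⬝ᵥ y = h l + c := by
  set M : Matrix (Fin 3) (Fin 3) ℝ := (edgeMatrix v).map (Int.castRingHom ℝ) with hM
  have hdet : IsUnit Mᵀ.det := by
    rw [Matrix.det_transpose, hM, ← RingHom.mapMatrix_apply, ← RingHom.map_det]
    exact hv.map _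
  refine ⟨Mᵀ⁻¹ *ᵥ (fun l => h l.succ - h 0), toR3 (v 0) ⬝ᵥ (Mᵀ⁻¹ *ᵥ (fun l => h l.succ - h 0)) - h 0,
    fun l => ?_⟩
  set y := Mᵀ⁻¹ *ᵥ (fun l : Fin 3 => h l.succ - h 0) with hy
  have hMy : Mᵀ *ᵥ y = fun l => h l.succ - h 0 := by
    rw [hy, Matrix.mulVec_mulVec, Matrix.mul_nonsing_inv _ hdet, Matrix.one_mulVec]
  refine Fin.cases (by ring) (fun i => ?_) l
  have := congrFun hMy i
  simp only [Matrix.mulVec, dotProduct, Matrix.transpose_apply, hM, edgeMatrix, Matrix.map_apply,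
    Matrix.of_apply, Fin.sum_univ_three, toR3, eq_intCast, Int.cast_sub, Int.cast_natCast]
    at this ⊢
  linarith

/-- Points of a unimodular simplex have barycentric coordinates of the same denominator. -/
theorem exists_barycentric {v : Fin 4 → Fin 3 → ℕ} (hv : IsUnit (edgeMatrix v).det)
    {z : R3} (hz : z ∈ convexHull ℝ (Set.range (toR3 ∘ v))) (k : ℕ) (u : Fin 3 → ℤ)
    (hu : (k : ℝ) • z = intToR3 u) :
    ∃ n : Fin 4 → ℕ, ∑ l, n l = k ∧ ∀ r, u r = ∑ l, (n l : ℤ) * v l r := by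
  obtain ⟨w, hw0, hw1, hwz⟩ : ∃ w : Fin 4 → ℝ, (∀ l, 0 ≤ w l) ∧ ∑ l, w l = 1 ∧
      ∑ l, w l • toR3 (v l) = z := by
    have := hz
    rw [convexHull_range_eq_exists_affineCombination] at this
    obtain ⟨s, w, h0, h1, h2⟩ := this
    refine ⟨fun l => if l ∈ s then w l else 0, fun l => ?_, by simpa using h1, ?_⟩
    · by_cases hl : l ∈ s <;> simp [hl, h0]
    · rw [Finset.affineCombination_eq_linear_combination _ _ _ h1] at h2
      simpa [ite_smul] using h2
  have hint : ∀ l : Fin 3, ∃ m : ℤ, (k : ℝ) * w l.succ = m := by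
    set M : Matrix (Fin 3) (Fin 3) ℝ := (edgeMatrix v).map (Int.castRingHom ℝ) with hM
    set g : Fin 3 → ℤ := fun r => u r - k * v 0 r with hg
    have h1 : M *ᵥ (fun l => (k : ℝ) * w l.succ) = Int.castRingHom ℝ ∘ g := by
      ext r
      have e1 := congrFun hu r
      rw [← hwz] at e1
      rw [Fin.sum_univ_succ] at hw1
      simp only [Matrix.mulVec, dotProduct, hM, edgeMatrix, Matrix.map_apply,
        Matrix.of_apply, Fin.sum_univ_succ, toR3, eq_intCast, Int.cast_sub, Int.cast_natCast,
        Pi.smul_apply, smul_eq_mul, Pi.add_apply, intToR3, Function.comp_apply, hg,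
        Int.cast_mul, Finset.univ_eq_empty, Finset.sum_empty, Pi.zero_apply] at e1 hw1 ⊢
      linear_combination e1 - (k : ℝ) * (v 0 r) * hw1
    have hdet : M.det = ((edgeMatrix v).det : ℤ) := by
      rw [hM, ← RingHom.mapMatrix_apply, ← RingHom.map_det]; simp
    have hadj : M.adjugate = (edgeMatrix v).adjugate.map (Int.castRingHom ℝ) := by
      rw [hM, ← RingHom.mapMatrix_apply, ← RingHom.map_adjugate]; rfl
    -- The scaled weights solve an integral system of determinant ±1, so multiplying by the adjugate
    -- shows that they are integers.
    have h2 := congrArg (M.adjugate *ᵥ ·) h1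
    simp only [Matrix.mulVec_mulVec, Matrix.adjugate_mul, Matrix.smul_mulVec, Matrix.one_mulVec]
      at h2
    intro l
    have h3 := congrFun h2 l
    rw [hadj, ← RingHom.map_mulVec, hdet] at h3
    simp only [Pi.smul_apply, smul_eq_mul, eq_intCast] at h3
    rcases Int.isUnit_iff.1 hv with hd | hd <;> rw [hd] at h3
    · exact ⟨((edgeMatrix v).adjugate *ᵥ g) l, by simpa using h3⟩
    · exact ⟨-((edgeMatrix v).adjugate *ᵥ g) l, by push_cast at h3 ⊢; linarith⟩
  have hint' : ∀ l, ∃ m : ℕ, (k : ℝ) * w l = m := by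
    have hnat : ∀ l, (∃ m : ℤ, (k : ℝ) * w l = m) → ∃ m : ℕ, (k : ℝ) * w l = m := by
      rintro l ⟨m, hm⟩
      have h0 : (0 : ℝ) ≤ m := hm ▸ mul_nonneg k.cast_nonneg (hw0 l)
      lift m to ℕ using by exact_mod_cast h0
      exact ⟨m, by simpa using hm⟩
    intro l
    refine hnat l (Fin.cases ?_ hint l)
    -- The weight of the first vertex follows from the others, since all scaled weights sum to `k`.
    choose m hm using hint
    refine ⟨k - ∑ l, m l, ?_⟩
    have : w 0 = 1 - ∑ l : Fin 3, w l.succ := by rw [← hw1, Fin.sum_univ_succ]; ring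
    rw [this, mul_sub, Finset.mul_sum]
    simp [hm]
  choose n hn using hint'
  refine ⟨n, ?_, fun r => ?_⟩
  · have : (k : ℝ) * ∑ l, w l = k := by rw [hw1, mul_one]
    rw [Finset.mul_sum, Finset.sum_congr rfl fun l _ => hn l] at this
    exact_mod_cast this
  · have := congrFun hu r
    rw [← hwz, Finset.smul_sum] at this
    simp only [smul_smul, hn, Finset.sum_apply, Pi.smul_apply, smul_eq_mul, toR3, intToR3] at this
    exact_mod_cast this.symm

/-! ### Maximal terms and the cells of the regular subdivision. -/

open Filter Topology

namespace TropicalPolynomial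

variable (f : TropicalPolynomial)

/-- The exponents of the terms that are maximal at `x`. -/
def maximizers (x : R3) : Set (Fin 3 → ℕ) :=
  {a | a ∈ f.support ∧ ∀ b ∈ f.support, f.term b x ≤ f.term a x}

variable {f}

theorem term_le_eval {a : Fin 3 → ℕ} (ha : a ∈ f.support) (x : R3) : f.term a x ≤ f.eval x :=
  Finset.le_sup' (fun a => f.term a x) ha

theorem exists_mem_maximizers (x : R3) : ∃ a, a ∈ f.maximizers x :=
  f.support.exists_max_image (fun a => f.term a x) f.nonempty

theorem term_eq_eval {a : Fin 3 → ℕ} {x : R3} (ha : a ∈ f.maximizers x) :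
    f.term a x = f.eval x :=
  (term_le_eval ha.1 x).antisymm (Finset.sup'_le _ _ ha.2)

theorem mem_maximizers_iff {a : Fin 3 → ℕ} {x : R3} :
    a ∈ f.maximizers x ↔ a ∈ f.support ∧ f.term a x = f.eval x :=
  ⟨fun h => ⟨h.1, term_eq_eval h⟩, fun h => ⟨h.1, fun _ hb => h.2 ▸ term_le_eval hb x⟩⟩

theorem finite_maximizers (x : R3) : (f.maximizers x).Finite :=
  f.support.finite_toSet.subset fun _ h => h.1

theorem mem_surface {a b : Fin 3 → ℕ} {x : R3} (ha : a ∈ f.maximizers x)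
    (hb : b ∈ f.maximizers x) (hab : a ≠ b) : x ∈ f.surface :=
  ⟨a, ha.1, b, hb.1, hab, term_eq_eval ha, term_eq_eval hb⟩

theorem term_add_smul (a : Fin 3 → ℕ) (x y : R3) (t : ℝ) :
    f.term a (x + t • y) = f.term a x + t * (toR3 a ⬝ᵥ y) := by
  simp only [term, dotProduct_add, dotProduct_smul, smul_eq_mul]; ring

variable (f) in
/-- The cell of the subdivision that is dual to the cell containing `x` in its relative interior. -/
def cellAt (x : R3) : Set R3 := convexHull ℝ (toR3 '' f.maximizers x)

/-- The functional defining a top face takes at the lifted point of `a` the value of the term `a` at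
`c`. Hence the face is spanned by the lifts of the exponents maximal at `c`, and cells of the
subdivision are indexed by points of the dual space. -/
theorem image_topFace (c : R3) :
    Prod.fst '' {q | q ∈ f.liftedPolytope ∧
      ∀ q' ∈ f.liftedPolytope, c ⬝ᵥ q'.1 + q'.2 ≤ c ⬝ᵥ q.1 + q.2} = f.cellAt c := by
  classical
  let φ : R3 × ℝ →ₗ[ℝ] ℝ :=
    { toFun := fun q => c ⬝ᵥ q.1 + q.2
      map_add' := fun q q' => by simp [dotProduct_add]; ring
      map_smul' := fun r q => by simp [dotProduct_smul]; ring }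
  let ι : (Fin 3 → ℕ) → R3 × ℝ := fun a => (toR3 a, f.coeff a)
  have hφ : ∀ a, φ (ι a) = f.term a c := fun a => by
    change c ⬝ᵥ toR3 a + f.coeff a = f.coeff a + toR3 a ⬝ᵥ c
    rw [dotProduct_comm, add_comm]
  have hmem : ∀ a ∈ f.support, ι a ∈ f.liftedPolytope := fun a ha =>
    subset_convexHull ℝ _ ⟨a, ha, rfl⟩
  have hbound : ∀ q ∈ f.liftedPolytope, φ q ≤ f.eval c := by
    have hsub : f.liftedPolytope ⊆ {q | φ q ≤ f.eval c} := by
      refine convexHull_min ?_ (convex_halfSpace_le φ.isLinear _)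
      rintro _ ⟨a, ha, rfl⟩
      exact (hφ a).trans_le (term_le_eval ha c)
    exact fun q hq => hsub hq
  have hι : LinearMap.fst ℝ R3 ℝ ∘ ι = toR3 := rfl
  have hcell : f.cellAt c = Prod.fst '' convexHull ℝ (ι '' f.maximizers c) := by
    have := (LinearMap.fst ℝ R3 ℝ).image_convexHull (ι '' f.maximizers c)
    rw [← Set.image_comp, hι] at this
    exact this.symm
  rw [hcell]
  congr 1
  refine Set.Subset.antisymm ?_ ?_
  · rintro q ⟨hq, hmax⟩
    obtain ⟨a0, ha0⟩ := exists_mem_maximizers (f := f) c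
    have hval : f.eval c ≤ φ q := by
      rw [← term_eq_eval ha0, ← hφ]; exact hmax _ (hmem a0 ha0.1)
    have hq' : q ∈ convexHull ℝ ((f.support.image ι : Finset _) : Set (R3 × ℝ)) := by
      rw [Finset.coe_image]; exact hq
    rw [Finset.mem_convexHull'] at hq'
    obtain ⟨w, hw0, hw1, hwq⟩ := hq'
    -- The weighted deficits are nonnegative with sum zero, so only lifts of maximal exponents carry
    -- weight.
    have hzero : ∀ z ∈ f.support.image ι, w z * (f.eval c - φ z) = 0 := by
      refine (Finset.sum_eq_zero_iff_of_nonneg fun z hz => mul_nonneg (hw0 z hz) ?_).1 ?_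
      · obtain ⟨a, ha, rfl⟩ := Finset.mem_image.1 hz
        exact sub_nonneg.2 (hbound _ (hmem a ha))
      · have hφq : φ q = ∑ z ∈ f.support.image ι, w z * φ z := by
          rw [← hwq, map_sum]; simp [-Finset.sum_image]
        have : ∑ z ∈ f.support.image ι, w z * (f.eval c - φ z) = f.eval c - φ q := by
          simp only [mul_sub, Finset.sum_sub_distrib, ← Finset.sum_mul, hw1, one_mul, hφq]
        rw [this]
        linarith [hbound q hq]
    rw [← hwq, ← Finset.sum_filter_of_ne (p := fun z => w z ≠ 0)]
    · refine (convex_convexHull ℝ _).sum_mem (fun z hz => hw0 z (Finset.mem_filter.1 hz).1) ?_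
        fun z hz => ?_
      · rw [Finset.sum_filter_ne_zero, hw1]
      · obtain ⟨hz, hwz⟩ := Finset.mem_filter.1 hz
        obtain ⟨a, ha, rfl⟩ := Finset.mem_image.1 hz
        refine subset_convexHull ℝ _ ⟨a, mem_maximizers_iff.2 ⟨ha, ?_⟩, rfl⟩
        have := (mul_eq_zero.1 (hzero _ hz)).resolve_left hwz
        rw [hφ] at this
        linarith
    · intro z _ hne hz
      exact hne (by rw [hz, zero_smul])
  · refine fun q hq => ⟨convexHull_mono (Set.image_mono fun a ha => ha.1) hq, fun q' hq' => ?_⟩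
    refine (hbound q' hq').trans ?_
    have hsub : convexHull ℝ (ι '' f.maximizers c) ⊆ {q | f.eval c ≤ φ q} := by
      refine convexHull_min ?_ (convex_halfSpace_ge φ.isLinear _)
      rintro _ ⟨a, ha, rfl⟩
      exact ((hφ a).trans (term_eq_eval ha)).ge
    exact hsub hq

theorem mem_subdivision {D : Set R3} : D ∈ f.subdivision ↔ ∃ x, D = f.cellAt x := by
  constructor
  · rintro ⟨_, ⟨c, rfl⟩, rfl⟩
    exact ⟨c, image_topFace c⟩
  · rintro ⟨c, rfl⟩
    exact ⟨_, ⟨c, rfl⟩, (image_topFace c).symm⟩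

theorem finite_subdivision : f.subdivision.Finite := by
  refine (f.support.finite_toSet.finite_subsets.image
    fun A => convexHull ℝ (toR3 '' A)).subset ?_
  intro D hD
  obtain ⟨x, rfl⟩ := mem_subdivision.1 hD
  exact ⟨f.maximizers x, fun _ h => h.1, rfl⟩

/-- In a smooth tropical polynomial every cell lies in a unimodular simplex of the subdivision. -/
theorem exists_unimodular (hs : f.IsSmooth) (x : R3) : ∃ (v : Fin 4 → Fin 3 → ℕ) (y : R3),
    IsUnit (edgeMatrix v).det ∧ f.maximizers y = Set.range v ∧
    f.cellAt x ⊆ convexHull ℝ (Set.range (toR3 ∘ v)) ∧ f.maximizers x ⊆ Set.range v := by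
  obtain ⟨P, hxP, hP⟩ := finite_subdivision.exists_le_maximal (mem_subdivision.2 ⟨x, rfl⟩)
  obtain ⟨y, hy⟩ := mem_subdivision.1 hP.prop
  obtain ⟨⟨v, hv, hvP⟩, -, -, hvol⟩ := hs P hP
  have hsub := range_subset_of_convexHull_eq hv (hvP.symm.trans hy)
  choose a ha hav using fun l => hsub ⟨l, rfl⟩
  obtain rfl : toR3 ∘ a = v := funext hav
  rw [hvP] at hvol
  have hdet := isUnit_det_edgeMatrix hvol
  -- Barycentric coordinates of a lattice point are natural numbers with sum 1. So the simplex has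
  -- no lattice points besides its vertices, and no exponent can be maximal without being a vertex.
  have hlattice : ∀ b, toR3 b ∈ convexHull ℝ (Set.range (toR3 ∘ a)) → b ∈ Set.range a := by
    intro b hb
    obtain ⟨n, hn, hu⟩ := exists_barycentric hdet hb 1 (fun r => (b r : ℤ))
      (by ext r; simp [toR3, intToR3])
    obtain ⟨l, -, hl⟩ : ∃ l ∈ Finset.univ, n l ≠ 0 :=
      Finset.exists_ne_zero_of_sum_ne_zero (by rw [hn]; exact one_ne_zero)
    have hrest : ∀ m, m ≠ l → n m = 0 := by
      intro m hm
      rw [← Finset.add_sum_erase _ _ (Finset.mem_univ l)] at hn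
      have := Finset.single_le_sum (f := n) (fun _ _ => Nat.zero_le _)
        (Finset.mem_erase.2 ⟨hm, Finset.mem_univ m⟩)
      omega
    have hl1 : n l = 1 := by
      rw [← hn, Finset.sum_eq_single l (fun m _ => hrest m) (by simp)]
    refine ⟨l, funext fun r => ?_⟩
    have := hu r
    rw [Finset.sum_eq_single l (fun m _ hm => by simp [hrest m hm]) (by simp), hl1] at this
    simpa using this.symm
  have hmem : ∀ z b, f.cellAt z ⊆ P → b ∈ f.maximizers z → b ∈ Set.range a := fun z b hz hb =>
    hlattice b (hvP ▸ hz (subset_convexHull ℝ _ ⟨b, hb, rfl⟩))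
  refine ⟨a, y, hdet, Set.Subset.antisymm (fun b => hmem y b hy.ge) ?_, hvP ▸ hxP,
    fun b => hmem x b hxP⟩
  rintro _ ⟨l, rfl⟩
  exact ha l

/-- For small `t > 0` the maximal terms at `x + t y` are among those at `x` that grow most in
direction `y`. -/
theorem eventually_term_lt {x y : R3} {a : Fin 3 → ℕ} (ha : a ∈ f.maximizers x) :
    ∀ᶠ t in 𝓝[>] (0 : ℝ), ∀ b ∈ f.support,
      (b ∈ f.maximizers x → toR3 b ⬝ᵥ y < toR3 a ⬝ᵥ y) →
        f.term b (x + t • y) < f.term a (x + t • y) := by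
  refine (Filter.eventually_all_finset _).2 fun b hb => ?_
  by_cases hbx : b ∈ f.maximizers x
  · filter_upwards [self_mem_nhdsWithin] with t ht hlt
    rw [term_add_smul, term_add_smul, term_eq_eval ha, term_eq_eval hbx]
    have := mul_lt_mul_of_pos_left (hlt hbx) (Set.mem_Ioi.1 ht)
    linarith
  · have hlt : f.term b x < f.term a x := by
      refine (ha.2 b hb).lt_of_ne fun h => hbx ?_
      exact mem_maximizers_iff.2 ⟨hb, h.trans (term_eq_eval ha)⟩
    have hcont : ∀ c, Continuous fun t : ℝ => f.term c (x + t • y) := fun c => by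
      simp only [term_add_smul]; fun_prop
    have := ((hcont b).tendsto 0).eventually_lt ((hcont a).tendsto 0) (by simpa using hlt)
    filter_upwards [nhdsWithin_le_nhds this] with t ht _ using ht

/-! ### Newton polytope -/

theorem degree_le_two (hd : f.HasDegree 2) {a : Fin 3 → ℕ} (ha : a ∈ f.support) :
    a 0 + a 1 + a 2 ≤ 2 := by
  have h1 : toR3 a ∈ Gam 2 := hd ▸ subset_convexHull ℝ _ ⟨a, ha, rfl⟩
  have h2 : Gam 2 ⊆ {x | (1 : R3) ⬝ᵥ x ≤ 2} := by
    refine convexHull_min ?_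
      (convex_halfSpace_le (dotProductBilin ℝ ℝ (1 : R3)).isLinear 2)
    rintro _ (rfl | ⟨i, rfl⟩) <;> simp [e]
  have := h2 h1
  simp only [Set.mem_ofPred_eq, one_dotProduct, Fin.sum_univ_three, toR3] at this
  exact_mod_cast this

/-- A vertex of the Newton polytope must be an exponent: the other admissible exponents lie in a
half-space that misses it. -/
theorem zero_mem_support (hd : f.HasDegree 2) : 0 ∈ f.support := by
  by_contra h
  have h1 : (0 : R3) ∈ f.newtonPolytope := by
    rw [hd]; exact subset_convexHull ℝ _ (Set.mem_insert _ _)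
  have h2 : f.newtonPolytope ⊆ {x | 1 ≤ (1 : R3) ⬝ᵥ x} := by
    refine convexHull_min ?_
      (convex_halfSpace_ge (dotProductBilin ℝ ℝ (1 : R3)).isLinear 1)
    rintro _ ⟨a, ha, rfl⟩
    have hne : a ≠ 0 := fun h0 => h (h0 ▸ ha)
    have : 1 ≤ a 0 + a 1 + a 2 := by
      by_contra hlt
      refine hne (funext fun r => ?_)
      fin_cases r <;> simp <;> omega
    simp only [Set.mem_ofPred_eq, one_dotProduct, Fin.sum_univ_three, toR3]
    exact_mod_cast this
  have := h2 h1
  norm_num at this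

theorem single_mem_support (hd : f.HasDegree 2) (i : Fin 3) : Pi.single i 2 ∈ f.support := by
  by_contra h
  have h1 : (2 : ℝ) • e i ∈ f.newtonPolytope := by
    rw [hd]; exact subset_convexHull ℝ _ (Set.mem_insert_of_mem _ ⟨i, by simp⟩)
  have h2 : f.newtonPolytope ⊆ {x | e i ⬝ᵥ x ≤ 1} := by
    refine convexHull_min ?_
      (convex_halfSpace_le (dotProductBilin ℝ ℝ (e i)).isLinear 1)
    rintro _ ⟨a, ha, rfl⟩
    have hne : a ≠ Pi.single i 2 := fun h0 => h (h0 ▸ ha)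
    have hdeg := degree_le_two hd ha
    have : a i ≤ 1 := by
      by_contra hlt
      refine hne (funext fun r => ?_)
      fin_cases i <;> fin_cases r <;> simp at hlt ⊢ <;> omega
    simp only [Set.mem_ofPred_eq, e, single_dotProduct, one_mul, toR3]
    exact_mod_cast this
  have := h2 h1
  norm_num [e] at this

/-! ### Coercivity and the cell through the center. -/

/-- The center of the Newton polytope. -/
noncomputable def center : R3 := fun _ => 1 / 2

/-- The center is interior to the simplex, so the terms at its four vertices suffice. With D the
bracket and S the sum of the coordinates, they give S ≤ 6D and x_i ≤ D/2 + S/4 ≤ 2D; then -S ≤ 2D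
gives x_i = S - x_j - x_k ≥ -6D. -/
theorem exists_norm_le (hd : f.HasDegree 2) :
    ∃ m : ℝ, ∀ x : R3, ‖x‖ ≤ 6 * (f.eval x - center ⬝ᵥ x - m) := by
  obtain ⟨m, hm⟩ : ∃ m : ℝ, ∀ a ∈ f.support, m ≤ f.coeff a := by
    obtain ⟨a, -, ha⟩ := f.support.exists_min_image f.coeff f.nonempty
    exact ⟨f.coeff a, ha⟩
  refine ⟨m, fun x => ?_⟩
  have h0 := term_le_eval (zero_mem_support hd) x
  have hc0 := hm _ (zero_mem_support hd)
  have hi := fun i => term_le_eval (single_mem_support hd i) x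
  have hci := fun i => hm _ (single_mem_support hd i)
  have hsingle : ∀ i, toR3 (Pi.single i 2) ⬝ᵥ x = 2 * x i := fun i => by
    fin_cases i <;> simp [toR3, dotProduct, Pi.single_apply]
  have hzero : toR3 0 ⬝ᵥ x = 0 := by simp [toR3, dotProduct]
  have hcenter : center ⬝ᵥ x = (x 0 + x 1 + x 2) / 2 := by
    simp only [center, dotProduct, Fin.sum_univ_three]; ring
  simp only [term, hsingle, hzero] at h0 hi
  rw [hcenter]
  have b0 := hi 0
  have b1 := hi 1
  have b2 := hi 2
  have c0 := hci 0
  have c1 := hci 1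
  have c2 := hci 2
  refine (pi_norm_le_iff_of_nonneg (by linarith)).2 fun i => ?_
  rw [Real.norm_eq_abs, abs_le]
  fin_cases i <;> simp only [Fin.zero_eta, Fin.mk_one, Fin.reduceFinMk] <;> constructor <;> linarith

theorem continuous_eval : Continuous f.eval := by
  refine Continuous.finset_sup'_apply f.nonempty fun a _ => ?_
  unfold term dotProduct
  fun_prop

/-- The center of the Newton polytope lies in some cell of the subdivision. -/
theorem exists_center_mem_cellAt (hd : f.HasDegree 2) : ∃ x, center ∈ f.cellAt x := by
  obtain ⟨m, hm⟩ := exists_norm_le hd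
  have hcont : Continuous fun x => f.eval x - center ⬝ᵥ x := by
    refine continuous_eval.sub ?_
    unfold dotProduct
    fun_prop
  have hlim : Tendsto (fun x => f.eval x - center ⬝ᵥ x) (cocompact R3) atTop := by
    refine tendsto_atTop_mono (f := fun x => ‖x‖ / 6 + m) (fun x => by linarith [hm x]) ?_
    exact tendsto_atTop_add_const_right _ _
      ((tendsto_norm_cocompact_atTop (E := R3)).atTop_div_const (by norm_num))
  obtain ⟨x, hx⟩ := hcont.exists_forall_le hlim
  refine ⟨x, by_contra fun hnot => ?_⟩
  -- If the center were outside the hull of the maximal exponents, a small step along a separating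
  -- direction would lower the function below its minimum.
  obtain ⟨φ, s, hφs, hsφ⟩ := geometric_hahn_banach_closed_point (convex_convexHull ℝ _)
    (((finite_maximizers x).image toR3).isClosed_convexHull ℝ) hnot
  obtain ⟨y, hy⟩ : ∃ y : R3, ∀ z, φ z = z ⬝ᵥ y :=
    ⟨fun i => φ (fun j => if i = j then 1 else 0), fun z => by
      simpa [dotProduct] using LinearMap.pi_apply_eq_sum_univ φ.toLinearMap z⟩
  obtain ⟨a, ha⟩ := exists_mem_maximizers (f := f) x
  obtain ⟨t, ht, ht0⟩ := ((eventually_term_lt (y := y) ha).and self_mem_nhdsWithin).exists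
  obtain ⟨b, hb⟩ := exists_mem_maximizers (f := f) (x + t • y)
  have hbx : b ∈ f.maximizers x := by
    by_contra h
    exact (ht b hb.1 fun h' => absurd h' h).not_ge (hb.2 a ha.1)
  have h1 := hx (x + t • y)
  have h2 : toR3 b ⬝ᵥ y < center ⬝ᵥ y := by
    rw [← hy, ← hy]
    exact (hφs _ (subset_convexHull ℝ _ ⟨b, hbx, rfl⟩)).trans hsφ
  simp only [← term_eq_eval hb, term_add_smul, term_eq_eval hbx, dotProduct_add, dotProduct_smul,
    smul_eq_mul] at h1
  have := mul_lt_mul_of_pos_left h2 (Set.mem_Ioi.1 ht0)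
  linarith

end TropicalPolynomial

/-! ### The edge through the center. -/

/-- Applied twice to barycentric multiplicities of sum 2, this produces the two endpoints of the
central edge. -/
theorem exists_eq_add_single {n : Fin 4 → ℕ} {k : ℕ} (hn : ∑ l, n l = k + 1) :
    ∃ (l : Fin 4) (n' : Fin 4 → ℕ), ∑ l, n' l = k ∧ n = n' + Pi.single l 1 := by
  obtain ⟨l, -, hl⟩ : ∃ l ∈ Finset.univ, n l ≠ 0 :=
    Finset.exists_ne_zero_of_sum_ne_zero (by rw [hn]; exact k.succ_ne_zero)
  have h : n = Function.update n l (n l - 1) + Pi.single l 1 := by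
    ext m
    rcases eq_or_ne m l with rfl | hm
    · simp only [Pi.add_apply, Function.update_self, Pi.single_eq_same]; omega
    · simp [hm]
  refine ⟨l, _, ?_, h⟩
  rw [h] at hn
  simpa [Finset.sum_add_distrib] using hn

theorem finrank_ker_dotProduct {w : R3} (hw : w ≠ 0) :
    Module.finrank ℝ (LinearMap.ker (dotProductBilin ℝ ℝ w)) = 2 := by
  have hne : (dotProductBilin ℝ ℝ w : R3 →ₗ[ℝ] ℝ) ≠ 0 := fun h =>
    hw (dotProduct_self_eq_zero.1 (LinearMap.congr_fun h w))
  have := Module.Dual.finrank_ker_add_one_of_ne_zero hne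
  simp only [Module.finrank_fin_fun] at this
  omega

/-- If every vector orthogonal to `w` is orthogonal to `z`, then `z` is a multiple of `w`. -/
theorem exists_eq_smul_of_ker_le {w z : R3}
    (h : ∀ x : R3, w ⬝ᵥ x = 0 → z ⬝ᵥ x = 0) : ∃ μ : ℝ, z = μ • w := by
  rcases eq_or_ne w 0 with rfl | hw
  · exact ⟨0, by simpa using h z (zero_dotProduct z)⟩
  · have hww : w ⬝ᵥ w ≠ 0 := fun h0 => hw (dotProduct_self_eq_zero.1 h0)
    set μ := (w ⬝ᵥ z) / (w ⬝ᵥ w)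
    have h1 : w ⬝ᵥ (z - μ • w) = 0 := by
      rw [dotProduct_sub, dotProduct_smul, smul_eq_mul, div_mul_cancel₀ _ hww, sub_self]
    have h2 : (z - μ • w) ⬝ᵥ (z - μ • w) = 0 := by
      rw [sub_dotProduct, h _ h1, smul_dotProduct, h1]; simp
    exact ⟨μ, sub_eq_zero.1 (dotProduct_self_eq_zero.1 h2)⟩

namespace TropicalPolynomial

variable {f : TropicalPolynomial}

/-- The subdivision of a smooth quadric has an edge through the center of the Newton polytope. -/
theorem exists_central_edge (hd : f.HasDegree 2) (hs : f.IsSmooth) :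
    ∃ (a b : Fin 3 → ℕ) (x : R3), (∀ r, a r + b r = 1) ∧ f.maximizers x = {a, b} := by
  obtain ⟨x, hx⟩ := exists_center_mem_cellAt hd
  obtain ⟨v, z, hdet, hz, hsub, -⟩ := exists_unimodular hs x
  obtain ⟨n, hn, hu⟩ := exists_barycentric hdet (hsub hx) 2 (fun _ => 1)
    (by ext r; simp [center, intToR3])
  obtain ⟨l, n', hn', rfl⟩ := exists_eq_add_single hn
  obtain ⟨m, n'', hn'', rfl⟩ := exists_eq_add_single hn'
  have hn0 : n'' = 0 := by
    ext r
    simpa using (Finset.sum_eq_zero_iff.1 hn'') r (Finset.mem_univ r)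
  subst hn0
  have hsum : ∀ r, v l r + v m r = 1 := by
    intro r
    have := hu r
    simp only [zero_add, Pi.add_apply, Nat.cast_add, add_mul, Finset.sum_add_distrib] at this
    have hone : ∀ q : Fin 4, ∑ t, ((Pi.single q 1 : Fin 4 → ℕ) t : ℤ) * v t r = v q r := by
      intro q
      rw [Finset.sum_eq_single q (fun t _ ht => by simp [ht]) (by simp)]
      simp
    rw [hone, hone] at this
    omega
  -- In this direction the two endpoints grow equally fast and strictly faster than the other
  -- vertices; a small step from the point dual to the simplex leaves exactly these two terms
  -- maximal.
  obtain ⟨y, c, hy⟩ := exists_interpolation hdet fun r => if r = l ∨ r = m then 0 else -1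
  have hmem : ∀ r, v r ∈ f.maximizers z := fun r => hz ▸ ⟨r, rfl⟩
  obtain ⟨t, ht⟩ := (eventually_term_lt (y := y) (hmem l)).exists
  have hlm : f.term (v l) (z + t • y) = f.term (v m) (z + t • y) := by
    rw [term_add_smul, term_add_smul, hy, hy, term_eq_eval (hmem l), term_eq_eval (hmem m)]
    simp
  have hsubset : ∀ b ∈ f.maximizers (z + t • y), b = v l ∨ b = v m := by
    intro b hb
    have hnot := fun h => (ht b hb.1 h).not_ge (hb.2 _ (hmem l).1)
    by_contra hne
    refine hnot fun hbz => ?_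
    rw [hz] at hbz
    obtain ⟨r, rfl⟩ := hbz
    have hr : ¬ (r = l ∨ r = m) := fun h => hne (h.imp (congrArg v) (congrArg v))
    rw [hy, hy, if_neg hr, if_pos (Or.inl rfl)]
    linarith
  refine ⟨v l, v m, z + t • y, hsum, Set.Subset.antisymm hsubset ?_⟩
  obtain ⟨b, hb⟩ := exists_mem_maximizers (f := f) (z + t • y)
  have hbl : f.term b (z + t • y) = f.term (v l) (z + t • y) := by
    rcases hsubset b hb with rfl | rfl
    · rfl
    · exact hlm.symm
  rintro _ (rfl | rfl)
  · exact mem_maximizers_iff.2 ⟨(hmem l).1, hbl ▸ term_eq_eval hb⟩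
  · exact mem_maximizers_iff.2 ⟨(hmem m).1, hlm ▸ hbl ▸ term_eq_eval hb⟩

/-! ### The cell dual to the central edge. -/

variable (f) in
/-- The points at which the terms with exponents `a` and `b` are both maximal. -/
def edgeDual (a b : Fin 3 → ℕ) : Set R3 := {x | a ∈ f.maximizers x ∧ b ∈ f.maximizers x}

theorem edgeDual_comm (a b : Fin 3 → ℕ) : f.edgeDual a b = f.edgeDual b a :=
  Set.ext fun _ => and_comm

theorem term_combo (a : Fin 3 → ℕ) (x y : R3) {r s : ℝ} (h : r + s = 1) :
    f.term a (r • x + s • y) = r * f.term a x + s * f.term a y := by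
  simp only [term, dotProduct_add, dotProduct_smul, smul_eq_mul]
  linear_combination -f.coeff a * h

theorem convex_edgeDual (a b : Fin 3 → ℕ) : Convex ℝ (f.edgeDual a b) := by
  have h : ∀ a, Convex ℝ {x | a ∈ f.maximizers x} := by
    intro a x hx y hy r s hr hs hrs
    refine ⟨hx.1, fun c hc => ?_⟩
    rw [term_combo _ _ _ hrs, term_combo _ _ _ hrs]
    exact add_le_add (mul_le_mul_of_nonneg_left (hx.2 c hc) hr)
      (mul_le_mul_of_nonneg_left (hy.2 c hc) hs)
  exact (h a).inter (h b)

theorem continuous_term (a : Fin 3 → ℕ) : Continuous (f.term a) := by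
  unfold term dotProduct
  fun_prop

theorem isClosed_edgeDual (a b : Fin 3 → ℕ) : IsClosed (f.edgeDual a b) := by
  have h : ∀ a, IsClosed {x | a ∈ f.maximizers x} := by
    intro a
    simp only [mem_maximizers_iff, Set.ofPred_and]
    exact isClosed_const.inter (isClosed_eq (continuous_term a) continuous_eval)
  exact (h a).inter (h b)

theorem dotProduct_sub_eq_zero {a b : Fin 3 → ℕ} {x y : R3} (hx : x ∈ f.edgeDual a b)
    (hy : y ∈ f.edgeDual a b) : (toR3 b - toR3 a) ⬝ᵥ (x - y) = 0 := by
  have h1 := (term_eq_eval hx.1).trans (term_eq_eval hx.2).symm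
  have h2 := (term_eq_eval hy.1).trans (term_eq_eval hy.2).symm
  simp only [term] at h1 h2
  rw [sub_dotProduct, dotProduct_sub, dotProduct_sub]
  linarith

theorem vectorSpan_le_ker {C : Set R3} {w : R3} (h : ∀ x ∈ C, ∀ y ∈ C, w ⬝ᵥ (x - y) = 0) :
    vectorSpan ℝ C ≤ LinearMap.ker (dotProductBilin ℝ ℝ w) := by
  rw [vectorSpan_def, Submodule.span_le]
  rintro _ ⟨x, hx, y, hy, rfl⟩
  exact h x hx y hy

/-- Averaging the two maximal terms shows that `f.eval x - center ⬝ᵥ x` is constant on the cell, and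
this function controls the norm. -/
theorem isCompact_edgeDual (hd : f.HasDegree 2) {a b : Fin 3 → ℕ} (hab : ∀ r, a r + b r = 1) :
    IsCompact (f.edgeDual a b) := by
  obtain ⟨m, hm⟩ := exists_norm_le hd
  refine Metric.isCompact_of_isClosed_isBounded (isClosed_edgeDual a b)
    (isBounded_iff_forall_norm_le.2 ⟨6 * ((f.coeff a + f.coeff b) / 2 - m), fun x hx => ?_⟩)
  refine (hm x).trans (le_of_eq ?_)
  have h1 := term_eq_eval hx.1
  have h2 := term_eq_eval hx.2
  have h3 : toR3 a ⬝ᵥ x + toR3 b ⬝ᵥ x = 2 * center ⬝ᵥ x := by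
    rw [← add_dotProduct, ← smul_eq_mul, ← smul_dotProduct]
    congr 1
    ext r
    have : (a r : ℝ) + b r = 1 := by exact_mod_cast hab r
    simpa [toR3, center] using this
  simp only [term] at h1 h2
  linarith

/-- Since no third term is maximal at `x`, a small step in any direction orthogonal to b - a stays
in the cell. -/
theorem dim_edgeDual {a b : Fin 3 → ℕ} (hab : a ≠ b) {x : R3} (hx : f.maximizers x = {a, b}) :
    dim (f.edgeDual a b) = 2 := by
  have hne : toR3 b - toR3 a ≠ 0 := fun h => hab (toR3_injective (sub_eq_zero.1 h)).symm
  have ha : a ∈ f.maximizers x := hx ▸ Set.mem_insert _ _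
  have hb : b ∈ f.maximizers x := hx ▸ Set.mem_insert_of_mem _ rfl
  suffices h : vectorSpan ℝ (f.edgeDual a b) =
      LinearMap.ker (dotProductBilin ℝ ℝ (toR3 b - toR3 a)) by
    rw [dim, h, finrank_ker_dotProduct hne]
  refine le_antisymm (vectorSpan_le_ker fun y hy z hz => dotProduct_sub_eq_zero hy hz) ?_
  intro y hy
  have hy' : toR3 b ⬝ᵥ y = toR3 a ⬝ᵥ y := by
    have : (toR3 b - toR3 a) ⬝ᵥ y = 0 := hy
    rwa [sub_dotProduct, sub_eq_zero] at this
  obtain ⟨t, ht, ht0⟩ := ((eventually_term_lt (y := y) ha).and self_mem_nhdsWithin).exists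
  have hterm : f.term b (x + t • y) = f.term a (x + t • y) := by
    rw [term_add_smul, term_add_smul, hy', term_eq_eval ha, term_eq_eval hb]
  have hle : ∀ c ∈ f.support, f.term c (x + t • y) ≤ f.term a (x + t • y) := by
    intro c hc
    by_cases hcx : c ∈ f.maximizers x
    · rw [hx] at hcx
      rcases hcx with rfl | rfl
      · exact le_rfl
      · exact hterm.le
    · exact (ht c hc fun h => absurd h hcx).le
  have hmem : x + t • y ∈ f.edgeDual a b :=
    ⟨⟨ha.1, hle⟩, ⟨hb.1, fun c hc => (hle c hc).trans hterm.ge⟩⟩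
  have := vsub_mem_vectorSpan ℝ hmem (show x ∈ f.edgeDual a b from ⟨ha, hb⟩)
  rw [vsub_eq_sub, add_sub_cancel_left] at this
  exact ((vectorSpan ℝ _).smul_mem_iff (Set.mem_Ioi.1 ht0).ne').1 this

theorem isTwoCell_edgeDual {a b : Fin 3 → ℕ} (hab : a ≠ b) {x : R3}
    (hx : f.maximizers x = {a, b}) : f.IsTwoCell (f.edgeDual a b) := by
  have ha : a ∈ f.maximizers x := hx ▸ Set.mem_insert _ _
  have hb : b ∈ f.maximizers x := hx ▸ Set.mem_insert_of_mem _ rfl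
  have hne : toR3 a ≠ toR3 b := fun h => hab (toR3_injective h)
  have hcell : f.cellAt x = convexHull ℝ (Set.range ![toR3 a, toR3 b]) := by
    rw [cellAt, hx, Set.image_pair, Matrix.range_cons_cons_empty]
  refine ⟨⟨f.cellAt x, mem_subdivision.2 ⟨x, rfl⟩, ?_, ?_⟩, dim_edgeDual hab hx⟩
  · rw [dim, Submodule.one_le_finrank_iff]
    have hsub := subset_convexHull ℝ (toR3 '' f.maximizers x)
    exact (Submodule.ne_bot_iff _).2 ⟨_, vsub_mem_vectorSpan ℝ (hsub ⟨a, ha, rfl⟩)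
      (hsub ⟨b, hb, rfl⟩), sub_ne_zero.2 hne⟩
  · have hext := range_subset_extremePoints (affineIndependent_of_ne ℝ hne)
    rw [← hcell] at hext
    refine Set.Subset.antisymm (fun y hy c hc hcext => ?_) fun y hy => ?_
    · have := extremePoints_convexHull_subset hcext
      rw [hx, Set.image_pair] at this
      rcases this with h | h
      · rw [toR3_injective h]; exact hy.1.2
      · rw [toR3_injective h]; exact hy.2.2
    · exact ⟨⟨ha.1, hy a ha.1 (hext ⟨0, rfl⟩)⟩, ⟨hb.1, hy b hb.1 (hext ⟨1, rfl⟩)⟩⟩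

/-! ### Uniqueness of the compact two-dimensional cell. -/

/-- A compact set is not invariant under translations in a fixed direction. -/
theorem false_of_ray_subset {C : Set R3} (hC : IsCompact C) {x u : R3} (hu : u ≠ 0)
    (h : ∀ t : ℝ, 0 ≤ t → x + t • u ∈ C) : False := by
  obtain ⟨R, hR⟩ := isBounded_iff_forall_norm_le.1 hC.isBounded
  have hu' : 0 < ‖u‖ := norm_pos_iff.2 hu
  have hR0 : 0 ≤ R := (norm_nonneg _).trans (hR _ (h 0 le_rfl))
  set t := (R + ‖x‖ + 1) / ‖u‖
  have ht : 0 ≤ t := by positivity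
  have h1 := hR _ (h t ht)
  have h2 : ‖t • u‖ ≤ ‖x + t • u‖ + ‖x‖ := by
    simpa using norm_sub_le (x + t • u) x
  rw [norm_smul, Real.norm_of_nonneg ht, div_mul_cancel₀ _ hu'.ne'] at h2
  linarith

/-- A compact two-dimensional cell is dual to an edge through the center. -/
theorem eq_edgeDual_of_isCompact (hd : f.HasDegree 2) {a b : Fin 3 → ℕ} {x : R3}
    (hab : ∀ r, a r + b r = 1) (hx : f.maximizers x = {a, b}) {C : Set R3}
    (hC : f.IsTwoCell C) (hcomp : IsCompact C) : C = f.edgeDual a b := by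
  obtain ⟨⟨D, hD, hdimD, rfl⟩, hdimC⟩ := hC
  obtain ⟨z, rfl⟩ := mem_subdivision.1 hD
  set E : Set (Fin 3 → ℕ) := {c | toR3 c ∈ (f.cellAt z).extremePoints ℝ}
  have hEz : E ⊆ f.maximizers z := fun c hc => by
    obtain ⟨c', hc', h⟩ := extremePoints_convexHull_subset hc
    exact toR3_injective h ▸ hc'
  have hdual : ∀ y, y ∈ f.dualCell (f.cellAt z) ↔ E ⊆ f.maximizers y := fun y =>
    ⟨fun hy c hc => ⟨(hEz hc).1, hy c (hEz hc).1 hc⟩, fun hy c hc hce => (hy hce).2⟩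
  obtain ⟨a', ha', b', hb', hne⟩ : E.Nontrivial := by
    by_contra hnt
    rw [Set.not_nontrivial_iff] at hnt
    have hsub : (f.cellAt z).Subsingleton := by
      have hhull := convexHull_extremePoints_of_finite ((finite_maximizers (f := f) z).image toR3)
      change convexHull ℝ ((f.cellAt z).extremePoints ℝ) = f.cellAt z at hhull
      have hs : ((f.cellAt z).extremePoints ℝ).Subsingleton := by
        intro p hp q hq
        obtain ⟨c, -, rfl⟩ := extremePoints_convexHull_subset hp
        obtain ⟨c', -, rfl⟩ := extremePoints_convexHull_subset hq
        rw [hnt hp hq]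
      rw [← hhull]
      rcases hs.eq_empty_or_singleton with h | ⟨p, h⟩ <;> rw [h] <;> simp
    have : dim (f.cellAt z) = 0 := by
      rw [dim, vectorSpan_of_subsingleton ℝ hsub, finrank_bot]
    omega
  -- the vertices of the dual cell are collinear
  have hline : ∀ c ∈ E, ∃ μ : ℝ, toR3 c - toR3 a' = μ • (toR3 b' - toR3 a') := by
    have hedge : ∀ c ∈ E, ∀ p ∈ f.dualCell (f.cellAt z), p ∈ f.edgeDual a' c :=
      fun c hc p hp => ⟨(hdual p).1 hp ha', (hdual p).1 hp hc⟩
    have hker : ∀ c ∈ E, vectorSpan ℝ (f.dualCell (f.cellAt z)) ≤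
        LinearMap.ker (dotProductBilin ℝ ℝ (toR3 c - toR3 a')) := fun c hc =>
      vectorSpan_le_ker fun p hp q hq =>
        dotProduct_sub_eq_zero (hedge c hc p hp) (hedge c hc q hq)
    have hb0 : toR3 b' - toR3 a' ≠ 0 := fun h => hne (toR3_injective (sub_eq_zero.1 h)).symm
    -- By dimension, the directions of the cell fill the plane orthogonal to b' - a'. Every c - a'
    -- is orthogonal to that plane, hence a multiple of b' - a'.
    have heq := Submodule.eq_of_le_of_finrank_eq (hker b' hb')
      (hdimC.trans (finrank_ker_dotProduct hb0).symm)
    refine fun c hc => exists_eq_smul_of_ker_le fun p hp => ?_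
    have : p ∈ vectorSpan ℝ (f.dualCell (f.cellAt z)) := heq ▸ hp
    exact hker c hc this
  -- no facet of the Newton polytope contains both `a'` and `b'`
  have hfacet : ∀ (u : R3) (k : ℝ), u ≠ 0 → (∀ c ∈ f.support, toR3 c ⬝ᵥ u ≤ k) →
      ¬ (toR3 a' ⬝ᵥ u = k ∧ toR3 b' ⬝ᵥ u = k) := by
    rintro u k hu hk ⟨hak, hbk⟩
    -- Otherwise all of `E` lies in the face with outer normal `u`, and moving along `u` keeps its
    -- terms maximal.
    refine false_of_ray_subset hcomp (x := z) hu fun t ht => (hdual _).2 fun c hc => ?_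
    obtain ⟨μ, hμ⟩ := hline c hc
    have hck : toR3 c ⬝ᵥ u = k := by
      rw [sub_eq_iff_eq_add.1 hμ, add_dotProduct, smul_dotProduct, sub_dotProduct, hak, hbk]
      simp
    refine ⟨(hEz hc).1, fun c' hc' => ?_⟩
    rw [term_add_smul, term_add_smul, hck]
    exact add_le_add ((hEz hc).2 c' hc') (mul_le_mul_of_nonneg_left (hk c' hc') ht)
  have hab' : ∀ r, a' r + b' r = 1 := by
    have hpos : ∀ r, 1 ≤ a' r + b' r := by
      intro r
      by_contra hlt
      refine hfacet (-e r) 0 (neg_ne_zero.2 fun h => ?_) (fun c _ => ?_) ⟨?_, ?_⟩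
      · simpa [e] using congrFun h r
      · simp [e, toR3]
      · have : a' r = 0 := by omega
        simp [e, toR3, this]
      · have : b' r = 0 := by omega
        simp [e, toR3, this]
    have hdeg : a' 0 + a' 1 + a' 2 + (b' 0 + b' 1 + b' 2) ≤ 3 := by
      by_contra hlt
      have h1 := degree_le_two hd (hEz ha').1
      have h2 := degree_le_two hd (hEz hb').1
      have hdot : ∀ c, toR3 c ⬝ᵥ (1 : R3) = ((c 0 + c 1 + c 2 : ℕ) : ℝ) := fun c => by
        simp [toR3, dotProduct, Fin.sum_univ_three]
      refine hfacet 1 2 one_ne_zero (fun c hc => ?_) ⟨?_, ?_⟩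
      · rw [hdot]; exact_mod_cast degree_le_two hd hc
      · rw [hdot]; exact_mod_cast (show a' 0 + a' 1 + a' 2 = 2 by omega)
      · rw [hdot]; exact_mod_cast (show b' 0 + b' 1 + b' 2 = 2 by omega)
    have p0 := hpos 0
    have p1 := hpos 1
    have p2 := hpos 2
    intro r
    fin_cases r <;> simp only [Fin.zero_eta, Fin.mk_one, Fin.reduceFinMk] <;> omega
  -- the two edges through the center coincide
  have hpair : (a' = a ∧ b' = b) ∨ (a' = b ∧ b' = a) := by
    have ha : a ∈ f.maximizers x := hx ▸ Set.mem_insert _ _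
    have hb : b ∈ f.maximizers x := hx ▸ Set.mem_insert_of_mem _ rfl
    -- Equal exponent sums make this difference constant. It is at most 0 at `z`, where a' and b'
    -- are maximal, and at least 0 at `x`, where a and b are; so it vanishes and a' is maximal at
    -- `x` too.
    have hsum : ∀ y, f.term a y + f.term b y - (f.term a' y + f.term b' y) =
        f.coeff a + f.coeff b - (f.coeff a' + f.coeff b') := by
      intro y
      have : toR3 a + toR3 b = toR3 a' + toR3 b' := by
        ext r
        have := (hab r).trans (hab' r).symm
        simp only [toR3, Pi.add_apply]
        exact_mod_cast this
      have := congrArg (· ⬝ᵥ y) this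
      simp only [add_dotProduct] at this
      simp only [term]
      linarith
    have hz1 := hsum z
    have hx1 := hsum x
    have i1 := (hEz ha').2 a ha.1
    have i2 := (hEz hb').2 b hb.1
    have i3 := ha.2 a' (hEz ha').1
    have i4 := hb.2 b' (hEz hb').1
    have ha'x : a' ∈ f.maximizers x :=
      mem_maximizers_iff.2 ⟨(hEz ha').1, (by linarith : f.term a' x = f.term a x).trans
        (term_eq_eval ha)⟩
    have hcancel : ∀ {c c' d d' : Fin 3 → ℕ}, (∀ r, c r + d r = 1) → (∀ r, c' r + d' r = 1) →
        c = c' → d = d' := by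
      rintro c _ d d' h h' rfl
      exact funext fun r => by have := h r; have := h' r; omega
    rw [hx] at ha'x
    rcases ha'x with h | h
    · exact Or.inl ⟨h, hcancel hab' hab h⟩
    · exact Or.inr ⟨h, hcancel hab' (fun r => (add_comm _ _).trans (hab r)) h⟩
  have hsame : f.edgeDual a' b' = f.edgeDual a b := by
    rcases hpair with ⟨rfl, rfl⟩ | ⟨rfl, rfl⟩
    · rfl
    · exact edgeDual_comm _ _
  rw [← hsame]
  refine Set.Subset.antisymm (fun y hy => ⟨(hdual y).1 hy ha', (hdual y).1 hy hb'⟩) fun y hy => ?_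
  refine (hdual y).2 fun c hc => mem_maximizers_iff.2 ⟨(hEz hc).1, ?_⟩
  obtain ⟨μ, hμ⟩ := hline c hc
  -- The terms `c` and a' agree at `z`, and their difference is constant along the plane of the
  -- cell.
  have hdot : (toR3 c - toR3 a') ⬝ᵥ (y - z) = 0 := by
    rw [hμ, smul_dotProduct, dotProduct_sub_eq_zero hy ⟨hEz ha', hEz hb'⟩, smul_zero]
  rw [← term_eq_eval hy.1]
  have hcz := (term_eq_eval (hEz hc)).trans (term_eq_eval (hEz ha')).symm
  simp only [term, sub_dotProduct, dotProduct_sub] at hcz hdot ⊢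
  linarith

end TropicalPolynomial

/-! ### The candidate tropical lines. -/

theorem segment_add_smul (p d : R3) {s t : ℝ} (h : s ≤ t) :
    segment ℝ (p + s • d) (p + t • d) = (fun r : ℝ => p + r • d) '' Set.Icc s t := by
  have := image_segment ℝ (AffineMap.lineMap p (p + d) : ℝ →ᵃ[ℝ] R3) s t
  rw [segment_eq_Icc h] at this
  have hfun : ⇑(AffineMap.lineMap p (p + d) : ℝ →ᵃ[ℝ] R3) = fun r : ℝ => p + r • d := by
    ext1 r
    simp [AffineMap.lineMap_apply, add_comm]
  rw [hfun] at this
  exact this.symm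

theorem intToR3_rayDir_castSucc (i : Fin 3) : intToR3 (rayDir i.castSucc) = -e i := by
  ext r
  fin_cases i <;> fin_cases r <;> simp [intToR3, rayDir, e, Fin.castSucc]

theorem intToR3_rayDir_three : intToR3 (rayDir 3) = 1 := by
  ext r
  fin_cases r <;> simp [intToR3, rayDir]

theorem toR3_dotProduct_neg_e (c : Fin 3 → ℕ) (i : Fin 3) : toR3 c ⬝ᵥ (-e i) = -(c i : ℝ) := by
  simp [e, toR3]

theorem toR3_dotProduct_one (c : Fin 3 → ℕ) :
    toR3 c ⬝ᵥ (1 : R3) = ((c 0 + c 1 + c 2 : ℕ) : ℝ) := by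
  simp [toR3, dotProduct, Fin.sum_univ_three]

theorem toR3_dotProduct_add_e (c : Fin 3 → ℕ) (i j : Fin 3) :
    toR3 c ⬝ᵥ (e i + e j) = ((c i + c j : ℕ) : ℝ) := by
  simp [e, toR3, dotProduct_add]

theorem sum_eq_of_perm (σ : Equiv.Perm (Fin 3)) (c : Fin 3 → ℕ) :
    c 0 + c 1 + c 2 = c (σ 0) + c (σ 1) + c (σ 2) := by
  rw [← Fin.sum_univ_three c, ← Equiv.sum_comp σ, Fin.sum_univ_three]

theorem funext_of_perm (σ : Equiv.Perm (Fin 3)) {α : Type*} {c d : Fin 3 → α}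
    (h0 : c (σ 0) = d (σ 0)) (h1 : c (σ 1) = d (σ 1)) (h2 : c (σ 2) = d (σ 2)) : c = d := by
  ext r
  obtain ⟨l, rfl⟩ := σ.surjective r
  fin_cases l
  exacts [h0, h1, h2]

/-- The candidate tropical line with vertices on the affine line `p + ℝ (e (σ 0) + e (σ 1))`. -/
def lineThrough (σ : Equiv.Perm (Fin 3)) (p : R3) (s t : ℝ) : Set R3 :=
  segment ℝ (p + s • (e (σ 0) + e (σ 1))) (p + t • (e (σ 0) + e (σ 1))) ∪
    (ray (p + s • (e (σ 0) + e (σ 1))) (rayDir (σ 0).castSucc) ∪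
      ray (p + s • (e (σ 0) + e (σ 1))) (rayDir (σ 1).castSucc)) ∪
    (ray (p + t • (e (σ 0) + e (σ 1))) (rayDir 3) ∪
      ray (p + t • (e (σ 0) + e (σ 1))) (rayDir (σ 2).castSucc))

theorem exists_perm_rays : ∀ σ : Equiv.Perm (Fin 3), ∃ τ : Equiv.Perm (Fin 4),
    τ 0 = (σ 0).castSucc ∧ τ 1 = (σ 1).castSucc ∧ τ 2 = 3 ∧ τ 3 = (σ 2).castSucc := by
  decide

theorem rayDir_balance : ∀ σ : Equiv.Perm (Fin 3),
    rayDir (σ 0).castSucc + rayDir (σ 1).castSucc + (Pi.single (σ 0) 1 + Pi.single (σ 1) 1) = 0 ∧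
    rayDir 3 + rayDir (σ 2).castSucc + -(Pi.single (σ 0) 1 + Pi.single (σ 1) 1) = 0 := by
  decide

theorem isTropicalLine_lineThrough (σ : Equiv.Perm (Fin 3)) (p : R3) {s t : ℝ} (h : s ≤ t) :
    IsTropicalLineWithVertices (p + s • (e (σ 0) + e (σ 1))) (p + t • (e (σ 0) + e (σ 1)))
      (lineThrough σ p s t) := by
  obtain ⟨τ, h0, h1, h2, h3⟩ := exists_perm_rays σ
  refine ⟨τ, by rw [h0, h1, h2, h3]; rfl, fun hne => ?_⟩
  have hst : s < t := h.lt_of_ne fun h' => hne (by rw [h'])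
  have h01 : σ 0 ≠ σ 1 := fun h => absurd (σ.injective h) (by decide)
  refine ⟨Pi.single (σ 0) 1 + Pi.single (σ 1) 1, fun d hd => ?_, ⟨t - s, sub_pos.2 hst, ?_⟩, ?_⟩
  · have := hd (σ 0)
    rw [Pi.add_apply, Pi.single_eq_same, Pi.single_eq_of_ne h01, add_zero] at this
    exact isUnit_of_dvd_one this
  · have : intToR3 (Pi.single (σ 0) 1 + Pi.single (σ 1) 1) = e (σ 0) + e (σ 1) := by
      ext r
      simp [intToR3, e, Pi.single_apply]
    rw [this, sub_smul]
    abel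
  · rw [h0, h1, h2, h3]
    exact rayDir_balance σ

theorem mem_lineThrough (σ : Equiv.Perm (Fin 3)) (p : R3) {s t r : ℝ} (hs : s ≤ r) (ht : r ≤ t) :
    p + r • (e (σ 0) + e (σ 1)) ∈ lineThrough σ p s t := by
  refine Or.inl (Or.inl ?_)
  rw [segment_add_smul _ _ (hs.trans ht)]
  exact ⟨r, ⟨hs, ht⟩, rfl⟩

/-- The second line meets the affine line carrying the segment of the first one only at `p`, so it
misses an endpoint of that segment other than `p`. -/
theorem lineThrough_ne {σ σ' : Equiv.Perm (Fin 3)} (h0 : σ' 0 = σ 0) (h1 : σ' 1 = σ 2)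
    (h2 : σ' 2 = σ 1) (p : R3) {s t s' t' : ℝ} (hs : s ≤ 0) (ht : 0 ≤ t) (hs' : s' ≤ 0)
    (ht' : 0 ≤ t') (hne : s ≠ 0 ∨ t ≠ 0) : lineThrough σ p s t ≠ lineThrough σ' p s' t' := by
  have n01 : σ 0 ≠ σ 1 := fun h => absurd (σ.injective h) (by decide)
  have n02 : σ 0 ≠ σ 2 := fun h => absurd (σ.injective h) (by decide)
  have n12 : σ 1 ≠ σ 2 := fun h => absurd (σ.injective h) (by decide)
  have key : ∀ r : ℝ, p + r • (e (σ 0) + e (σ 1)) ∈ lineThrough σ' p s' t' → r = 0 := by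
    intro r hr
    rw [lineThrough, segment_add_smul _ _ (hs'.trans ht')] at hr
    simp only [ray, intToR3_rayDir_castSucc, intToR3_rayDir_three, h0, h1, h2] at hr
    rcases hr with (⟨q, -, hq⟩ | ⟨q, hq0, hq⟩ | ⟨q, hq0, hq⟩) | ⟨q, hq0, hq⟩ | ⟨q, hq0, hq⟩ <;>
    · have c0 := congrFun hq (σ 0)
      have c1 := congrFun hq (σ 1)
      have c2 := congrFun hq (σ 2)
      simp [e, n01, n02, n12, n01.symm, n02.symm, n12.symm] at c0 c1 c2
      try linarith
  intro heq
  have := key s (heq ▸ mem_lineThrough σ p le_rfl (hs.trans ht))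
  have := key t (heq ▸ mem_lineThrough σ p (hs.trans ht) le_rfl)
  tauto

/-! ### Tropical lines contained in the surface. -/

namespace TropicalPolynomial

variable {f : TropicalPolynomial}

theorem edgeDual_subset_surface {a b : Fin 3 → ℕ} (hab : a ≠ b) : f.edgeDual a b ⊆ f.surface :=
  fun _ hx => mem_surface hx.1 hx.2 hab

/-- Both exponents lie on the face of the Newton polytope with outer normal `u`, so no term
overtakes theirs along the ray. -/
theorem ray_subset_surface {a b : Fin 3 → ℕ} (hab : a ≠ b) {q : R3} (hq : q ∈ f.edgeDual a b)
    {u : Fin 3 → ℤ} {k : ℝ} (ha : toR3 a ⬝ᵥ intToR3 u = k) (hb : toR3 b ⬝ᵥ intToR3 u = k)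
    (hk : ∀ c ∈ f.support, toR3 c ⬝ᵥ intToR3 u ≤ k) : ray q u ⊆ f.surface := by
  rintro _ ⟨t, ht, rfl⟩
  refine edgeDual_subset_surface hab ⟨⟨hq.1.1, fun c hc => ?_⟩, ⟨hq.2.1, fun c hc => ?_⟩⟩ <;>
    rw [term_add_smul, term_add_smul]
  · rw [ha]; exact add_le_add (hq.1.2 c hc) (mul_le_mul_of_nonneg_left (hk c hc) ht)
  · rw [hb]; exact add_le_add (hq.2.2 c hc) (mul_le_mul_of_nonneg_left (hk c hc) ht)

/-- Where a line leaves the cell dual to an edge, a term that grows faster becomes maximal. -/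
theorem exists_maximizer_of_exit {a b : Fin 3 → ℕ} {q d : R3} (hq : q ∈ f.edgeDual a b)
    (hd : toR3 a ⬝ᵥ d = toR3 b ⬝ᵥ d) (hexit : ∀ r : ℝ, 0 < r → q + r • d ∉ f.edgeDual a b) :
    ∃ c ∈ f.maximizers q, toR3 a ⬝ᵥ d < toR3 c ⬝ᵥ d := by
  by_contra! hcon
  obtain ⟨r, hr, hr0⟩ := ((eventually_term_lt (y := d) hq.1).and self_mem_nhdsWithin).exists
  refine hexit r hr0 ?_
  have hle : ∀ c ∈ f.support, f.term c (q + r • d) ≤ f.term a (q + r • d) := by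
    intro c hc
    by_cases h : c ∈ f.maximizers q → toR3 c ⬝ᵥ d < toR3 a ⬝ᵥ d
    · exact (hr c hc h).le
    · push Not at h
      rw [term_add_smul, term_add_smul, (hcon c h.1).antisymm h.2, term_eq_eval h.1,
        term_eq_eval hq.1]
  refine ⟨⟨hq.1.1, hle⟩, hq.2.1, fun c hc => (hle c hc).trans_eq ?_⟩
  rw [term_add_smul, term_add_smul, hd, term_eq_eval hq.1, term_eq_eval hq.2]

/-- The exit exponent at the lower end shares a zero coordinate `σ 0` with `b` and `σ 1` with `a`.
The one at the upper end has degree 2 like `b` and a zero coordinate `σ 2` like `a`. These four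
coincidences give the four rays. The exit exponents are recorded for the proof that the two lines
differ. -/
theorem exists_line (hd : f.HasDegree 2) (σ : Equiv.Perm (Fin 3)) {a b : Fin 3 → ℕ}
    (hab : ∀ r, a r + b r = 1) (ha0 : a (σ 0) = 1) (ha1 : a (σ 1) = 0) (ha2 : a (σ 2) = 0)
    {p : R3} (hp : p ∈ f.edgeDual a b) :
    ∃ s t : ℝ, s ≤ 0 ∧ 0 ≤ t ∧
      AreExitPoints (f.edgeDual a b) p (e (σ 0) + e (σ 1))
        (p + s • (e (σ 0) + e (σ 1))) (p + t • (e (σ 0) + e (σ 1))) ∧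
      lineThrough σ p s t ⊆ f.surface ∧
      (∃ c ∈ f.maximizers (p + s • (e (σ 0) + e (σ 1))), c (σ 0) = 0 ∧ c (σ 1) = 0) ∧
      ∃ c ∈ f.maximizers (p + t • (e (σ 0) + e (σ 1))), c (σ 0) + c (σ 1) = 2 := by
  set d := e (σ 0) + e (σ 1)
  set C := f.edgeDual a b
  have hb0 : b (σ 0) = 0 := by have := hab (σ 0); omega
  have hb1 : b (σ 1) = 1 := by have := hab (σ 1); omega
  have hb2 : b (σ 2) = 1 := by have := hab (σ 2); omega
  have hab_ne : a ≠ b := fun h => by rw [h, hb0] at ha0; exact absurd ha0 (by decide)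
  have had : toR3 a ⬝ᵥ d = 1 := by rw [toR3_dotProduct_add_e, ha0, ha1]; norm_num
  have hbd : toR3 b ⬝ᵥ d = 1 := by rw [toR3_dotProduct_add_e, hb0, hb1]; norm_num
  have hd0 : d ≠ 0 := fun h => by rw [h, dotProduct_zero] at had; exact zero_ne_one had
  have hcomp : IsCompact {r : ℝ | p + r • d ∈ C} := by
    have hemb : IsClosedEmbedding fun r : ℝ => p + r • d :=
      (Homeomorph.addLeft p).isClosedEmbedding.comp (isClosedEmbedding_smul_left hd0)
    exact hemb.isCompact_preimage (isCompact_edgeDual hd hab)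
  have hmem0 : (0 : ℝ) ∈ {r : ℝ | p + r • d ∈ C} := by simpa using hp
  obtain ⟨s, hs⟩ := hcomp.exists_isLeast ⟨0, hmem0⟩
  obtain ⟨t, ht⟩ := hcomp.exists_isGreatest ⟨0, hmem0⟩
  have hs0 : s ≤ 0 := hs.2 hmem0
  have ht0 : 0 ≤ t := ht.2 hmem0
  have hsC : p + s • d ∈ C := hs.1
  have htC : p + t • d ∈ C := ht.1
  obtain ⟨c, hc, hc01⟩ : ∃ c ∈ f.maximizers (p + s • d), c (σ 0) = 0 ∧ c (σ 1) = 0 := by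
    obtain ⟨c, hc, hlt⟩ := exists_maximizer_of_exit (d := -d) hsC
      (by rw [dotProduct_neg, dotProduct_neg, had, hbd]) fun r hr hmem => by
        have h1 : s - r ∈ {r : ℝ | p + r • d ∈ C} := by
          change p + (s - r) • d ∈ C
          convert hmem using 1
          module
        linarith [hs.2 h1]
    rw [dotProduct_neg, dotProduct_neg, neg_lt_neg_iff, had, toR3_dotProduct_add_e] at hlt
    have : c (σ 0) + c (σ 1) < 1 := by exact_mod_cast hlt
    exact ⟨c, hc, by omega, by omega⟩
  obtain ⟨c', hc', hc'01⟩ : ∃ c ∈ f.maximizers (p + t • d), c (σ 0) + c (σ 1) = 2 := by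
    obtain ⟨c, hc, hlt⟩ := exists_maximizer_of_exit (d := d) htC
      (by rw [had, hbd]) fun r hr hmem => by
        have h1 : t + r ∈ {r : ℝ | p + r • d ∈ C} := by
          change p + (t + r) • d ∈ C
          convert hmem using 1
          module
        linarith [ht.2 h1]
    rw [had, toR3_dotProduct_add_e] at hlt
    have : 1 < c (σ 0) + c (σ 1) := by exact_mod_cast hlt
    have hdeg := degree_le_two hd hc.1
    rw [sum_eq_of_perm σ] at hdeg
    exact ⟨c, hc, by omega⟩
  have hne : ∀ {c c' : Fin 3 → ℕ} (l : Fin 3), c l ≠ c' l → c ≠ c' := fun l h h' => h (h' ▸ rfl)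
  have hneg : ∀ {c₁ c₂ : Fin 3 → ℕ} {q : R3} (i : Fin 3), c₁ ≠ c₂ → c₁ ∈ f.maximizers q →
      c₂ ∈ f.maximizers q → c₁ i = 0 → c₂ i = 0 → ray q (rayDir i.castSucc) ⊆ f.surface := by
    intro c₁ c₂ q i h12 h1 h2 h1i h2i
    refine ray_subset_surface (k := 0) h12 ⟨h1, h2⟩ ?_ ?_ fun c _ => ?_ <;>
      rw [intToR3_rayDir_castSucc, toR3_dotProduct_neg_e]
    · simp [h1i]
    · simp [h2i]
    · simp
  have hc'deg := degree_le_two hd hc'.1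
  rw [sum_eq_of_perm σ] at hc'deg
  refine ⟨s, t, hs0, ht0, ⟨s, t, hs, ht, rfl, rfl⟩, ?_, ⟨c, hc, hc01⟩, ⟨c', hc', hc'01⟩⟩
  refine Set.union_subset (Set.union_subset ?_ (Set.union_subset ?_ ?_)) (Set.union_subset ?_ ?_)
  · exact ((convex_edgeDual a b).segment_subset hsC htC).trans (edgeDual_subset_surface hab_ne)
  · exact hneg _ (hne (σ 1) (by omega)) hc hsC.2 hc01.1 hb0
  · exact hneg _ (hne (σ 0) (by omega)) hc hsC.1 hc01.2 ha1
  · refine ray_subset_surface (k := 2) (hne (σ 2) (by omega)) ⟨hc', htC.2⟩ ?_ ?_ fun z hz => ?_ <;>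
      rw [intToR3_rayDir_three, toR3_dotProduct_one]
    · rw [sum_eq_of_perm σ]; exact_mod_cast (by omega)
    · rw [sum_eq_of_perm σ, hb0, hb1, hb2]; norm_num
    · exact_mod_cast degree_le_two hd hz
  · refine hneg _ (fun h => ?_) hc' htC.1 (by omega) ha2
    rw [h, ha0, ha1] at hc'01
    exact absurd hc'01 (by decide)

/-! ### Non-degeneracy. -/

/-- In a unimodular simplex no vertex is the midpoint of two others. -/
theorem eq_of_add_eq_two_mul {v : Fin 4 → Fin 3 → ℕ} (hv : IsUnit (edgeMatrix v).det)
    {a b c : Fin 3 → ℕ} (ha : a ∈ Set.range v) (hb : b ∈ Set.range v) (hc : c ∈ Set.range v)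
    (h : ∀ r, b r + c r = 2 * a r) : b = a := by
  obtain ⟨l, rfl⟩ := ha
  obtain ⟨m, rfl⟩ := hb
  obtain ⟨n, rfl⟩ := hc
  obtain ⟨y, k, hy⟩ := exists_interpolation hv fun r => if r = l then 1 else 0
  have hsum : toR3 (v m) + toR3 (v n) = (2 : ℝ) • toR3 (v l) := by
    ext r
    have := h r
    simp only [toR3, Pi.add_apply, Pi.smul_apply, smul_eq_mul]
    exact_mod_cast this
  have := congrArg (· ⬝ᵥ y) hsum
  simp only [add_dotProduct, smul_dotProduct, hy, smul_eq_mul, if_true] at this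
  by_cases hm : m = l
  · rw [hm]
  · rw [if_neg hm] at this
    split_ifs at this <;> linarith

/-- The two exit segments through a point of the compact cell are not both degenerate. -/
theorem false_of_degenerate (hd : f.HasDegree 2) (hs : f.IsSmooth) (σ : Equiv.Perm (Fin 3))
    {a b c₁ c₂ c₃ c₄ : Fin 3 → ℕ} (hab : ∀ r, a r + b r = 1) (ha0 : a (σ 0) = 1)
    (ha1 : a (σ 1) = 0) (ha2 : a (σ 2) = 0) {p : R3} (hp : p ∈ f.edgeDual a b)
    (h₁ : c₁ ∈ f.maximizers p) (h₁' : c₁ (σ 0) = 0 ∧ c₁ (σ 1) = 0)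
    (h₂ : c₂ ∈ f.maximizers p) (h₂' : c₂ (σ 0) + c₂ (σ 1) = 2)
    (h₃ : c₃ ∈ f.maximizers p) (h₃' : c₃ (σ 0) = 0 ∧ c₃ (σ 2) = 0)
    (h₄ : c₄ ∈ f.maximizers p) (h₄' : c₄ (σ 0) + c₄ (σ 2) = 2) : False := by
  classical
  obtain ⟨v, -, hdet, -, -, hsub⟩ := exists_unimodular hs p
  have hb0 : b (σ 0) = 0 := by have := hab (σ 0); omega
  have hb1 : b (σ 1) = 1 := by have := hab (σ 1); omega
  have hb2 : b (σ 2) = 1 := by have := hab (σ 2); omega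
  have hdeg : ∀ c ∈ f.maximizers p, c (σ 0) + c (σ 1) + c (σ 2) ≤ 2 := fun c hc =>
    sum_eq_of_perm σ c ▸ degree_le_two hd hc.1
  have d1 := hdeg _ h₁
  have d2 := hdeg _ h₂
  have d3 := hdeg _ h₃
  have d4 := hdeg _ h₄
  have hne : ∀ {c c' : Fin 3 → ℕ}, (c (σ 0) ≠ c' (σ 0) ∨ c (σ 1) ≠ c' (σ 1) ∨
      c (σ 2) ≠ c' (σ 2)) → c ≠ c' := by
    rintro c c' h rfl
    tauto
  have hc1a : c₁ ≠ a := hne (by omega)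
  have hc1b : c₁ ≠ b := hne (by omega)
  have hcard : ({a, b, c₁, c₂} : Finset (Fin 3 → ℕ)).card = 4 := by
    have hba : b ≠ a := hne (by omega)
    have hc2a : c₂ ≠ a := hne (by omega)
    have hc2b : c₂ ≠ b := hne (by omega)
    have hc21 : c₂ ≠ c₁ := hne (by omega)
    rw [Finset.card_insert_of_notMem (by simp [hba.symm, hc1a.symm, hc2a.symm]),
      Finset.card_insert_of_notMem (by simp [hc1b.symm, hc2b.symm]),
      Finset.card_insert_of_notMem (by simp [hc21.symm]), Finset.card_singleton]
  -- Four distinct maximal exponents already exhaust the vertices of the unimodular simplex.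
  have hall : ∀ c ∈ f.maximizers p, c = a ∨ c = b ∨ c = c₁ ∨ c = c₂ := by
    have himg : ({a, b, c₁, c₂} : Finset (Fin 3 → ℕ)) ⊆ Finset.univ.image v := by
      intro c hc
      simp only [Finset.mem_insert, Finset.mem_singleton] at hc
      rw [← Finset.mem_coe, Finset.coe_image, Finset.coe_univ, Set.image_univ]
      rcases hc with rfl | rfl | rfl | rfl
      exacts [hsub hp.1, hsub hp.2, hsub h₁, hsub h₂]
    have heq := Finset.eq_of_subset_of_card_le himg (by
      rw [hcard]; exact Finset.card_image_le)
    intro c hc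
    have : c ∈ Finset.univ.image v := by
      rw [← Finset.mem_coe, Finset.coe_image, Finset.coe_univ, Set.image_univ]; exact hsub hc
    rw [← heq] at this
    simpa using this
  have mid : ∀ {c : Fin 3 → ℕ}, c ∈ f.maximizers p → c₁ (σ 0) + c₂ (σ 0) = 2 * c (σ 0) →
      c₁ (σ 1) + c₂ (σ 1) = 2 * c (σ 1) → c₁ (σ 2) + c₂ (σ 2) = 2 * c (σ 2) → c₁ = c := by
    intro c hc e0 e1 e2
    refine eq_of_add_eq_two_mul hdet (hsub hc) (hsub h₁) (hsub h₂) (congrFun ?_)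
    exact funext_of_perm σ (c := fun r => c₁ r + c₂ r) (d := fun r => 2 * c r) e0 e1 e2
  -- Only two cases survive. If c₃ = c₁ and c₄ = c₂, these are 0 and 2e_i, with midpoint `a`; if c₃
  -- = c₂ and c₄ = c₁, they are 2e_j and 2e_k, with midpoint `b`.
  rcases hall c₃ h₃ with h | h | h | h
  · exact hne (by omega) h
  · exact hne (by omega) h
  · subst h
    rcases hall c₄ h₄ with h | h | h | h
    · exact hne (by omega) h
    · exact hne (by omega) h
    · exact hne (by omega) h
    · subst h
      exact hc1a (mid hp.1 (by omega) (by omega) (by omega))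
  · subst h
    rcases hall c₄ h₄ with h | h | h | h
    · exact hne (by omega) h
    · exact hne (by omega) h
    · subst h
      exact hc1b (mid hp.2 (by omega) (by omega) (by omega))
    · exact hne (by omega) h

/-- An edge through the center joins some `e i` with the sum of the other two basis vectors. -/
theorem exists_perm_of_add_eq_one (hd : f.HasDegree 2) {a b : Fin 3 → ℕ} (ha : a ∈ f.support)
    (hb : b ∈ f.support) (hab : ∀ r, a r + b r = 1) :
    ∃ σ : Equiv.Perm (Fin 3), (a (σ 0) = 1 ∧ a (σ 1) = 0 ∧ a (σ 2) = 0) ∨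
      (b (σ 0) = 1 ∧ b (σ 1) = 0 ∧ b (σ 2) = 0) := by
  have hone : ∀ c : Fin 3 → ℕ, c 0 + c 1 + c 2 = 1 →
      ∃ σ : Equiv.Perm (Fin 3), c (σ 0) = 1 ∧ c (σ 1) = 0 ∧ c (σ 2) = 0 := by
    intro c hc
    rcases (by omega : c 0 = 1 ∨ c 1 = 1 ∨ c 2 = 1) with h | h | h
    · exact ⟨1, by simp; omega⟩
    · exact ⟨Equiv.swap 0 1, by
        rw [Equiv.swap_apply_left, Equiv.swap_apply_right,
          Equiv.swap_apply_of_ne_of_ne (by decide) (by decide)]; omega⟩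
    · exact ⟨Equiv.swap 0 2, by
        rw [Equiv.swap_apply_left, Equiv.swap_apply_right,
          Equiv.swap_apply_of_ne_of_ne (by decide) (by decide)]; omega⟩
  have h0 := hab 0
  have h1 := hab 1
  have h2 := hab 2
  have hda := degree_le_two hd ha
  have hdb := degree_le_two hd hb
  rcases (by omega : a 0 + a 1 + a 2 = 1 ∨ b 0 + b 1 + b 2 = 1) with h | h
  · obtain ⟨σ, hσ⟩ := hone a h
    exact ⟨σ, Or.inl hσ⟩
  · obtain ⟨σ, hσ⟩ := hone b h
    exact ⟨σ, Or.inr hσ⟩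

end TropicalPolynomial
end TropicalQuadric

open TropicalQuadric TropicalPolynomial in
theorem mainTheorem1 (f : TropicalQuadric.TropicalPolynomial)
    (hdeg : f.HasDegree 2) (hsmooth : f.IsSmooth) :
    (∃! C : Set TropicalQuadric.R3, f.IsTwoCell C ∧ IsCompact C) ∧
    ∀ C : Set TropicalQuadric.R3, f.IsTwoCell C → IsCompact C →
      ∃ σ : Equiv.Perm (Fin 3),
        (∀ x ∈ C, ∀ y ∈ C,
          (-TropicalQuadric.e (σ 0) + TropicalQuadric.e (σ 1) + TropicalQuadric.e (σ 2)) ⬝ᵥ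
            (x - y) = 0) ∧
        ∀ p ∈ C, ∃ q₁ q₂ q₁' q₂' : TropicalQuadric.R3, ∃ L L' : Set TropicalQuadric.R3,
          TropicalQuadric.AreExitPoints C p
            (TropicalQuadric.e (σ 0) + TropicalQuadric.e (σ 1)) q₁ q₂ ∧
          TropicalQuadric.AreExitPoints C p
            (TropicalQuadric.e (σ 0) + TropicalQuadric.e (σ 2)) q₁' q₂' ∧
          TropicalQuadric.IsTropicalLineWithVertices q₁ q₂ L ∧
          TropicalQuadric.IsTropicalLineWithVertices q₁' q₂' L' ∧
          L ≠ L' ∧ p ∈ L ∧ p ∈ L' ∧ L ⊆ f.surface ∧ L' ⊆ f.surface := by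
  obtain ⟨a, b, x, σ, hab, hx, ha0, ha1, ha2⟩ : ∃ (a b : Fin 3 → ℕ) (x : R3)
      (σ : Equiv.Perm (Fin 3)), (∀ r, a r + b r = 1) ∧ f.maximizers x = {a, b} ∧
      a (σ 0) = 1 ∧ a (σ 1) = 0 ∧ a (σ 2) = 0 := by
    obtain ⟨a, b, x, hab, hx⟩ := exists_central_edge hdeg hsmooth
    have ha : a ∈ f.maximizers x := hx ▸ Set.mem_insert _ _
    have hb : b ∈ f.maximizers x := hx ▸ Set.mem_insert_of_mem _ rfl
    obtain ⟨σ, h | h⟩ := exists_perm_of_add_eq_one hdeg ha.1 hb.1 hab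
    · exact ⟨a, b, x, σ, hab, hx, h⟩
    · exact ⟨b, a, x, σ, fun r => (add_comm _ _).trans (hab r), hx.trans (Set.pair_comm a b), h⟩
  have hb0 : b (σ 0) = 0 := by have := hab (σ 0); omega
  have hb1 : b (σ 1) = 1 := by have := hab (σ 1); omega
  have hb2 : b (σ 2) = 1 := by have := hab (σ 2); omega
  have hne : a ≠ b := fun h => by rw [h, hb0] at ha0; exact absurd ha0 (by decide)
  refine ⟨⟨f.edgeDual a b, ⟨isTwoCell_edgeDual hne hx, isCompact_edgeDual hdeg hab⟩,
    fun C hC => eq_edgeDual_of_isCompact hdeg hab hx hC.1 hC.2⟩, fun C hC hcomp => ?_⟩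
  obtain rfl := eq_edgeDual_of_isCompact hdeg hab hx hC hcomp
  refine ⟨σ, fun y hy z hz => ?_, fun p hp => ?_⟩
  · have n01 : σ 0 ≠ σ 1 := fun h => absurd (σ.injective h) (by decide)
    have n02 : σ 0 ≠ σ 2 := fun h => absurd (σ.injective h) (by decide)
    have n12 : σ 1 ≠ σ 2 := fun h => absurd (σ.injective h) (by decide)
    have hnormal : -e (σ 0) + e (σ 1) + e (σ 2) = toR3 b - toR3 a := by
      apply funext_of_perm σ <;>
        simp [e, toR3, n01, n02, n12, n01.symm, n02.symm, n12.symm, ha0, ha1, ha2, hb0, hb1, hb2]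
    rw [hnormal]
    exact dotProduct_sub_eq_zero hy hz
  -- The situation is symmetric in j and k, so the second line is the first construction with these
  -- two indices exchanged.
  · set σ' : Equiv.Perm (Fin 3) := σ * Equiv.swap 1 2 with hσ'
    have h0 : σ' 0 = σ 0 := by
      rw [hσ', Equiv.Perm.mul_apply, Equiv.swap_apply_of_ne_of_ne (by decide) (by decide)]
    have h1 : σ' 1 = σ 2 := by rw [hσ', Equiv.Perm.mul_apply, Equiv.swap_apply_left]
    have h2 : σ' 2 = σ 1 := by rw [hσ', Equiv.Perm.mul_apply, Equiv.swap_apply_right]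
    obtain ⟨s, t, hs, ht, hexit, hL, ⟨c₁, h₁, h₁'⟩, c₂, h₂, h₂'⟩ :=
      exists_line hdeg σ hab ha0 ha1 ha2 hp
    obtain ⟨s', t', hs', ht', hexit', hL', ⟨c₃, h₃, h₃'⟩, c₄, h₄, h₄'⟩ :=
      exists_line hdeg σ' hab (h0 ▸ ha0) (h1 ▸ ha2) (h2 ▸ ha1) hp
    have hnd : (s ≠ 0 ∨ t ≠ 0) ∨ (s' ≠ 0 ∨ t' ≠ 0) := by
      by_contra! hcon
      obtain ⟨⟨rfl, rfl⟩, rfl, rfl⟩ := hcon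
      simp only [zero_smul, add_zero] at h₁ h₂ h₃ h₄
      rw [h0, h1] at h₃' h₄'
      exact false_of_degenerate hdeg hsmooth σ hab ha0 ha1 ha2 hp h₁ h₁' h₂ h₂' h₃ h₃' h₄ h₄'
    have hmem := mem_lineThrough σ p hs ht
    have hmem' := mem_lineThrough σ' p hs' ht'
    have hline' := isTropicalLine_lineThrough σ' p (hs'.trans ht')
    rw [zero_smul, add_zero] at hmem hmem'
    rw [h0, h1] at hexit' hline'
    refine ⟨_, _, _, _, lineThrough σ p s t, lineThrough σ' p s' t', hexit, hexit',
      isTropicalLine_lineThrough σ p (hs.trans ht), hline', ?_, hmem, hmem', hL, hL'⟩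
    rcases hnd with hnd | hnd
    · exact lineThrough_ne h0 h1 h2 p hs ht hs' ht' hnd
    · exact (lineThrough_ne h0.symm h2.symm h1.symm p hs' ht' hs ht hnd).symm
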